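/- There are absolute constants $c_1,c_2>0$ such that the following holds. Let $k\ge 1$, and consider the system $x_{t+1}=Ax_t+Bu_t+w_t$, $y_t=Cx_t+Du_t$ ($t\ge 0$), with $x_t,w_t\in\mathbb R^n$, $u_t\in\mathbb R^m$, $y_t\in\mathbb R^r$ and $\|A\|_2<1$ (spectral norm). For a real random variable let $\|X\|_{\psi_2}=\inf\{c>0:\mathbb E[\exp(X^2/c^2)]\le 2\}$, and for a random vector let $\|W\|_{\psi_2}=\sup_{\|v\|_2\le 1}\|W^Tv\|_{\psi_2}$. Put $\mathcal F_t=\sigma(x_0,w_0,\dots,w_{t-1})$. Let $\eta,\gamma>0$ and assume: (i) $\|x_0\|_{\psi_2}\le\eta$, and for all $t$, $\|w_t\|_{\psi_2}\le\eta$ conditionally on $\mathcal F_t$; (ii) for some $0\le p<\frac1{4k-2}$ there are independent Bernoulli$(p)$ variables $\xi_0,\xi_1,\dots$, with $\xi_t$ independent of $\mathcal F_t$ and $\{\xi_t=0\}\subseteq\{w_t=0\}$ for all $t$; (iii) the inputs $u_0,u_1,\dots$ are independent, $u_t\sim N(0,\gamma^2I_m)$, and the sequence $(u_t)_{t\ge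 0}$ is independent of $(\xi_t)_{t\ge 0}$. Let $q=1-(1-p)^{2k-1}$, and let $G_k^*=[D\ \ CB\ \ CAB\ \cdots\ CA^{2k-2}B]\in\mathbb R^{r\times 2km}$. Then $q<\frac12$. Moreover, let $\delta\in(0,1]$ and let $T$ be an integer with $T\ge c_1$ and $$T\ \ge\ c_1\,\frac{k}{(1-2q)^2}\Big[km\log\Big(\frac{km}{1-2q}\Big)+\log\Big(\frac r\delta\Big)\Big].$$ Then, with probability at least $1-\delta$, every minimizer $\hat G_k$ of $$G\ \mapsto\ \sum_{t=2k-1}^{T+2k-2}\big\|y_t-G\,[u_t^T\ u_{t-1}^T\ \cdots\ u_{t-2k+1}^T]^T\big\|_1\qquad\text{over } G\in\mathbb R^{r\times 2km}$$ satisfies $$\|G_k^*-\hat G_k\|_F\ \le\ c_2\,\frac{\|A^{2k-1}\|_2\,\|C\|_2\,\sqrt r}{(1-\|A\|_2)(1-2q)}\Big(\frac\eta\gamma+\sqrt m\,\|B\|_2\Big).$$ In particular, the same bound holds with $\|A\|_2^{2k-1}$ in place of $\|A^{2k-1}\|_2$. -/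

import Mathlib

open MeasureTheory ProbabilityTheory
open scoped ENNReal BigOperators

noncomputable section

/-- The sub-Gaussian norm `inf {c > 0 : 𝔼[exp (X² / c²)] ≤ 2}` of a real random variable,
equal to `∞` if no such `c` exists (that is, if `X` is not sub-Gaussian). -/
def psi2Norm {Ω : Type*} [MeasurableSpace Ω] (X : Ω → ℝ) (P : Measure Ω) : ℝ≥0∞ :=
  ⨅ (c : ℝ) (_ : 0 < c)
    (_ : ∫⁻ ω, ENNReal.ofReal (Real.exp (X ω ^ 2 / c ^ 2)) ∂P ≤ 2), ENNReal.ofReal c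

/-- The sub-Gaussian norm of a random vector: the supremum of the sub-Gaussian norms of `Wᵀ v`
over `‖v‖₂ ≤ 1`. -/
def vecPsi2Norm {Ω : Type*} [MeasurableSpace Ω] {d : ℕ}
    (W : Ω → EuclideanSpace ℝ (Fin d)) (P : Measure Ω) : ℝ≥0∞ :=
  ⨆ (v : EuclideanSpace ℝ (Fin d)) (_ : ‖v‖ ≤ 1), psi2Norm (fun ω => inner ℝ (W ω) v) P

/-- The random variable `(x₀, w₀, …, w_{t-1})`, which generates the σ-algebra `ℱ_t`. -/
def history {Ω : Type*} {d : ℕ} (x₀ : Ω → EuclideanSpace ℝ (Fin d))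
    (w : ℕ → Ω → EuclideanSpace ℝ (Fin d)) (t : ℕ) :
    Ω → EuclideanSpace ℝ (Fin d) × (Fin t → EuclideanSpace ℝ (Fin d)) :=
  fun ω => (x₀ ω, fun s => w s ω)

/-- `‖W‖_{ψ₂} ≤ η` conditionally on `H`: for almost every value `h` of `H`, the conditional law of
`W` given `H = h` has sub-Gaussian norm at most `η`. -/
def CondPsi2Le {Ω β : Type*} [MeasurableSpace Ω] [MeasurableSpace β] {d : ℕ}
    (P : Measure Ω) [IsFiniteMeasure P] (W : Ω → EuclideanSpace ℝ (Fin d)) (H : Ω → β)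
    (η : ℝ) : Prop :=
  ∀ᵐ h ∂(P.map H), vecPsi2Norm id (condDistrib W H P h) ≤ ENNReal.ofReal η

/-- The spectral norm: the operator norm with respect to Euclidean norms. -/
def specNorm {a b : ℕ} (M : Matrix (Fin a) (Fin b) ℝ) : ℝ :=
  ‖(Matrix.toEuclideanLin M).toContinuousLinearMap‖

/-- The Frobenius norm. -/
def frobNorm {α β : Type*} [Fintype α] [Fintype β] (M : Matrix α β ℝ) : ℝ :=
  √(∑ i, ∑ j, M i j ^ 2)

/-- The Markov parameter matrix `[D, CB, CAB, …, CA^{2k-2}B]`; the column `(j, l)` is the `l`-th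
column of the `j`-th block, `j = 0, …, 2k-1`. -/
def markovMatrix {n m r : ℕ} (k : ℕ) (A : Matrix (Fin n) (Fin n) ℝ) (B : Matrix (Fin n) (Fin m) ℝ)
    (C : Matrix (Fin r) (Fin n) ℝ) (D : Matrix (Fin r) (Fin m) ℝ) :
    Matrix (Fin r) (Fin (2 * k) × Fin m) ℝ :=
  Matrix.of fun i c => if c.1.val = 0 then D i c.2 else (C * A ^ (c.1.val - 1) * B) i c.2

/-- The stacked input `[u_tᵀ, u_{t-1}ᵀ, …, u_{t-2k+1}ᵀ]ᵀ`, used for `t ≥ 2k-1` only. -/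
def stackedInput {m : ℕ} (k : ℕ) (u : ℕ → EuclideanSpace ℝ (Fin m)) (t : ℕ) :
    Fin (2 * k) × Fin m → ℝ :=
  fun c => u (t - c.1.val) c.2

/-- The objective `∑_{t=2k-1}^{T+2k-2} ‖y_t - G U_t‖₁` of the `ℓ₁`-norm estimator. -/
def l1Loss {m r : ℕ} (k T : ℕ) (u : ℕ → EuclideanSpace ℝ (Fin m))
    (y : ℕ → EuclideanSpace ℝ (Fin r)) (G : Matrix (Fin r) (Fin (2 * k) × Fin m) ℝ) : ℝ :=
  ∑ t ∈ Finset.Icc (2 * k - 1) (T + 2 * k - 2),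
    ∑ i, |y t i - (G.mulVec (stackedInput k u t)) i|

/-- `G` is a solution to the `ℓ₁`-norm estimator. -/
def IsL1Estimate {m r : ℕ} (k T : ℕ) (u : ℕ → EuclideanSpace ℝ (Fin m))
    (y : ℕ → EuclideanSpace ℝ (Fin r)) (G : Matrix (Fin r) (Fin (2 * k) × Fin m) ℝ) : Prop :=
  ∀ G', l1Loss k T u y G ≤ l1Loss k T u y G'

end

/-!
Let `σ_s = 1` if no attack occurs during the `2k - 1` steps which relate window `s` to its output,
and `σ_s = -1` otherwise. Unrolling the system writes `y` as `G* U_s` plus a residual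
`C A ^ (2k - 1) x_s`, plus an arbitrary error when `σ_s = -1`. Comparing a minimizer `G` with `G*`
row by row therefore bounds `∑ σ_s |⟨v, U_s⟩|`, for `v` a row of `G* - G`, by twice the sum of the
residuals. The former has positive drift because `σ` and `U` are independent and
`𝔼 σ_s = 1 - 2q > 0`. Windows whose starts agree mod `2k` are independent, so Jensen's inequality
over the residue classes concentrates the sum, and a union bound over an integer grid makes the
lower bound uniform in `v`. The residuals are summed along a geometric series and controlled by
sub-Gaussian exponential moments.
-/

section ExponentialMoment

variable {Ω ι : Type*} [MeasurableSpace Ω] {P : Measure Ω}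

/-- The exponential moment `𝔼[exp X]` of a real random variable, as an element of `[0, ∞]` so that
its finiteness need not be known beforehand. -/
noncomputable def expMoment (X : Ω → ℝ) (P : Measure Ω) : ℝ≥0∞ :=
  ∫⁻ ω, ENNReal.ofReal (Real.exp (X ω)) ∂P

theorem expMoment_mono {X Y : Ω → ℝ} (h : ∀ ω, X ω ≤ Y ω) : expMoment X P ≤ expMoment Y P :=
  lintegral_mono fun ω => ENNReal.ofReal_le_ofReal (Real.exp_le_exp.2 (h ω))

theorem expMoment_comp {β : Type*} [MeasurableSpace β] {U : Ω → β} (hU : Measurable U) {f : β → ℝ}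
    (hf : Measurable f) : expMoment (fun ω => f (U ω)) P = expMoment f (P.map U) :=
  (lintegral_map (f := fun b => ENNReal.ofReal (Real.exp (f b))) (by fun_prop) hU).symm

theorem expMoment_eq_ofReal_integral {X : Ω → ℝ} (hX : Integrable (fun ω => Real.exp (X ω)) P) :
    expMoment X P = ENNReal.ofReal (∫ ω, Real.exp (X ω) ∂P) :=
  (ofReal_integral_eq_lintegral_ofReal hX (.of_forall fun _ => (Real.exp_pos _).le)).symm

theorem expMoment_convexComb_le (I : Finset ι) {α : ι → ℝ} (hα : ∀ i ∈ I, 0 ≤ α i)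
    (hα1 : ∑ i ∈ I, α i = 1) {Y : ι → Ω → ℝ} (hY : ∀ i ∈ I, Measurable (Y i)) {K : ℝ≥0∞}
    (h : ∀ i ∈ I, expMoment (Y i) P ≤ K) :
    expMoment (fun ω => ∑ i ∈ I, α i * Y i ω) P ≤ K := by
  have jensen (ω : Ω) : ENNReal.ofReal (Real.exp (∑ i ∈ I, α i * Y i ω))
      ≤ ∑ i ∈ I, ENNReal.ofReal (α i) * ENNReal.ofReal (Real.exp (Y i ω)) := by
    have := convexOn_exp.map_sum_le (p := fun i => Y i ω) hα hα1 (fun _ _ => Set.mem_univ _)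
    refine (ENNReal.ofReal_le_ofReal this).trans_eq ?_
    rw [ENNReal.ofReal_sum_of_nonneg fun i hi => smul_nonneg (hα i hi) (Real.exp_pos _).le]
    exact Finset.sum_congr rfl fun i hi => ENNReal.ofReal_mul (hα i hi)
  calc expMoment (fun ω => ∑ i ∈ I, α i * Y i ω) P
      ≤ ∫⁻ ω, ∑ i ∈ I, ENNReal.ofReal (α i) * ENNReal.ofReal (Real.exp (Y i ω)) ∂P :=
        lintegral_mono jensen
    _ = ∑ i ∈ I, ENNReal.ofReal (α i) * expMoment (Y i) P := by
        have hmeas (i) (hi : i ∈ I) : Measurable fun ω => ENNReal.ofReal (Real.exp (Y i ω)) := by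
          have := hY i hi; fun_prop
        rw [lintegral_finsetSum' _ fun i hi => ((hmeas i hi).const_mul _).aemeasurable]
        exact Finset.sum_congr rfl fun i hi => lintegral_const_mul _ (hmeas i hi)
    _ ≤ ∑ i ∈ I, ENNReal.ofReal (α i) * K := by gcongr with i hi; exact h i hi
    _ = K := by rw [← Finset.sum_mul, ← ENNReal.ofReal_sum_of_nonneg hα, hα1]; simp

theorem measure_lt_le_of_expMoment_le {Y : Ω → ℝ} (hY : Measurable Y) {b s : ℝ}
    (h : expMoment Y P ≤ ENNReal.ofReal (Real.exp b)) :
    P {ω | s < Y ω} ≤ ENNReal.ofReal (Real.exp (b - s)) := by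
  have hpos : 0 < Real.exp s := Real.exp_pos s
  calc P {ω | s < Y ω}
      ≤ P {ω | ENNReal.ofReal (Real.exp s) ≤ ENNReal.ofReal (Real.exp (Y ω))} :=
        measure_mono fun ω hω => ENNReal.ofReal_le_ofReal (Real.exp_le_exp.2 (le_of_lt hω))
    _ ≤ expMoment Y P / ENNReal.ofReal (Real.exp s) :=
        meas_ge_le_lintegral_div (by fun_prop) (by simpa using hpos) ENNReal.ofReal_ne_top
    _ ≤ ENNReal.ofReal (Real.exp b) / ENNReal.ofReal (Real.exp s) := by gcongr
    _ = ENNReal.ofReal (Real.exp (b - s)) := by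
        rw [← ENNReal.ofReal_div_of_pos hpos, Real.exp_sub]

theorem expMoment_sum_of_iIndepFun [Fintype ι] {X : ι → Ω → ℝ} (hX : ∀ i, Measurable (X i))
    (hind : iIndepFun X P) :
    expMoment (fun ω => ∑ i, X i ω) P = ∏ i, expMoment (X i) P := by
  have : IsProbabilityMeasure P := hind.isProbabilityMeasure
  simp_rw [expMoment, Real.exp_sum]
  simp_rw [ENNReal.ofReal_prod_of_nonneg fun i _ => (Real.exp_pos (X i _)).le]
  exact lintegral_prod_eq_prod_lintegral_of_indepFun Finset.univ _
    (hind.comp (fun _ x => ENNReal.ofReal (Real.exp x)) fun _ => by fun_prop)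
    fun i => by have := hX i; fun_prop

end ExponentialMoment

section Independence

variable {Ω ι ι' κ : Type*} {mΩ : MeasurableSpace Ω} {P : Measure Ω}

theorem iIndep_biSup_of_pairwise_disjoint {m : ι → MeasurableSpace Ω} (hm : ∀ i, m i ≤ mΩ)
    (hind : iIndep m P) {S : κ → Set ι} (hS : Pairwise fun k l => Disjoint (S k) (S l)) :
    iIndep (fun k => ⨆ i ∈ S k, m i) P := by
  classical
  rw [iIndep_iff]
  intro K f hf
  induction K using Finset.induction_on with
  | empty => have := hind.isProbabilityMeasure; simp
  | insert k K hk ih =>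
    have disj : Disjoint (S k) (⋃ l ∈ K, S l) :=
      Set.disjoint_iUnion₂_right.2 fun l hl => hS fun h => hk (h ▸ hl)
    have inter_meas : MeasurableSet[⨆ i ∈ ⋃ l ∈ K, S l, m i] (⋂ l ∈ K, f l) := by
      refine Finset.measurableSet_biInter K fun l hl => ?_
      have : ⨆ i ∈ S l, m i ≤ ⨆ i ∈ ⋃ l ∈ K, S l, m i :=
        biSup_mono fun i hi => Set.mem_biUnion hl hi
      exact this _ (hf l (Finset.mem_insert_of_mem hl))
    rw [Finset.prod_insert hk, ← ih fun l hl => hf l (Finset.mem_insert_of_mem hl),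
      Finset.set_biInter_insert]
    exact (Indep_iff _ _ _).1 (indep_iSup_of_disjoint hm hind disj) _ _
      (hf k (Finset.mem_insert_self k K)) inter_meas

theorem iIndep_sumElim {m : ι → MeasurableSpace Ω} {m' : ι' → MeasurableSpace Ω}
    (hm : iIndep m P) (hm' : iIndep m' P) (h : Indep (⨆ i, m i) (⨆ i, m' i) P) :
    iIndep (Sum.elim m m') P := by
  rw [iIndep_iff]
  intro K f hf
  have split : ⋂ i ∈ K, f i
      = (⋂ i ∈ K.toLeft, f (.inl i)) ∩ ⋂ i ∈ K.toRight, f (.inr i) := by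
    ext ω
    simp [Sum.forall]
  rw [split, Finset.prod_sum_eq_prod_toLeft_mul_prod_toRight,
    ← hm.meas_biInter fun i hi => hf _ (Finset.mem_toLeft.1 hi),
    ← hm'.meas_biInter fun i hi => hf _ (Finset.mem_toRight.1 hi)]
  refine (Indep_iff _ _ _).1 h _ _ (Finset.measurableSet_biInter _ fun i hi => ?_)
    (Finset.measurableSet_biInter _ fun i hi => ?_)
  · exact le_iSup m i _ (hf _ (Finset.mem_toLeft.1 hi))
  · exact le_iSup m' i _ (hf _ (Finset.mem_toRight.1 hi))

theorem iIndepFun_of_dependsOn {β γ : Type*} [MeasurableSpace β] [MeasurableSpace γ]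
    {X : ι → Ω → β} (hX : ∀ i, Measurable (X i)) (hind : iIndepFun X P) {S : κ → Set ι}
    (hS : Pairwise fun k l => Disjoint (S k) (S l)) {F : κ → (ι → β) → γ}
    (hF : ∀ k, Measurable (F k)) (hdep : ∀ k, DependsOn (F k) (S k)) :
    iIndepFun (fun k ω => F k fun i => X i ω) P := by
  classical
  have := hind.isProbabilityMeasure
  obtain ⟨ω₀⟩ : Nonempty Ω := nonempty_of_isProbabilityMeasure P
  rw [iIndepFun_iff_iIndep] at hind ⊢
  have blocks := iIndep_biSup_of_pairwise_disjoint (fun i => (hX i).comap_le) hind hS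
  refine (iIndep_iff _ _).2 fun K f hf => blocks.meas_biInter fun k hk => ?_
  have freeze : (fun ω => F k fun i => X i ω)
      = fun ω => F k fun i => if i ∈ S k then X i ω else X i ω₀ :=
    funext fun ω => hdep k fun i hi => by rw [if_pos hi]
  have block_meas : Measurable[⨆ i ∈ S k, MeasurableSpace.comap (X i) inferInstance]
      fun ω i => if i ∈ S k then X i ω else X i ω₀ := by
    refine @measurable_pi_lambda _ _ _ (_) _ _ fun i => ?_
    by_cases hi : i ∈ S k
    · simp only [if_pos hi]
      exact (comap_measurable (X i)).mono (le_iSup₂_of_le i hi le_rfl) le_rfl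
    · simp only [if_neg hi, measurable_const]
  have F_meas : Measurable[⨆ i ∈ S k, MeasurableSpace.comap (X i) inferInstance]
      fun ω => F k fun i => X i ω := freeze ▸ (hF k).comp block_meas
  exact F_meas.comap_le _ (hf k hk)

theorem iIndepFun_prodMk {β γ : Type*} [MeasurableSpace β] [MeasurableSpace γ]
    {X : ι → Ω → β} {Y : ι → Ω → γ} (hXm : ∀ i, Measurable (X i)) (hYm : ∀ i, Measurable (Y i))
    (hX : iIndepFun X P) (hY : iIndepFun Y P)
    (hXY : IndepFun (fun ω i => X i ω) (fun ω i => Y i ω) P) :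
    iIndepFun (fun i ω => (X i ω, Y i ω)) P := by
  rw [iIndepFun_iff_iIndep] at hX hY ⊢
  rw [IndepFun_iff_Indep, MeasurableSpace.comap_process_pi,
    MeasurableSpace.comap_process_pi] at hXY
  have blocks := iIndep_biSup_of_pairwise_disjoint
    (S := fun i : ι => {.inl i, .inr i})
    (Sum.forall.2 ⟨fun i => (hXm i).comap_le, fun i => (hYm i).comap_le⟩)
    (iIndep_sumElim hX hY hXY) (fun i j hij => by simp [hij.symm])
  simp only [iSup_pair, Sum.elim_inl, Sum.elim_inr, ← MeasurableSpace.comap_prodMk] at blocks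
  exact blocks

end Independence

section LocallyDependent

variable {Ω : Type*} [MeasurableSpace Ω] {P : Measure Ω}

theorem half_div_le_card_filter_modEq {L T : ℕ} (hL : 0 < L) (hLT : L ≤ T) (j : ℕ) :
    (T : ℝ) / (2 * L) ≤ ((Finset.range T).filter (· ≡ j [MOD L])).card := by
  rw [← Nat.count_eq_card_filter_range, Nat.count_modEq_card T hL]
  have floor_half : T ≤ 2 * (L * (T / L)) := by
    have := Nat.lt_mul_div_succ T hL
    have := Nat.mul_le_mul_left L (Nat.div_pos hLT hL)
    lia
  have : (T : ℝ) ≤ 2 * (L * (T / L : ℕ)) := by exact_mod_cast floor_half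
  calc (T : ℝ) / (2 * L) ≤ (T / L : ℕ) := by rw [div_le_iff₀ (by positivity)]; linarith
    _ ≤ _ := by exact_mod_cast Nat.le_add_right _ _

theorem sum_range_eq_sum_modEq {L : ℕ} (hL : 0 < L) (T : ℕ) (f : ℕ → ℝ) :
    ∑ s ∈ Finset.range T, f s
      = ∑ j ∈ Finset.range L, ∑ s ∈ (Finset.range T).filter (· ≡ j [MOD L]), f s := by
  rw [← Finset.sum_fiberwise_of_maps_to (g := (· % L))
    fun s _ => Finset.mem_range.2 (Nat.mod_lt s hL)]
  refine Finset.sum_congr rfl fun j hj => ?_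
  simp only [Nat.ModEq, Nat.mod_eq_of_lt (Finset.mem_range.1 hj)]

theorem expMoment_sum_le_exp_neg_of_iIndepFun {g : ℕ → Ω → ℝ} (hg : ∀ s, Measurable (g s))
    {c : ℝ} (h : ∀ s, expMoment (g s) P ≤ ENNReal.ofReal (Real.exp (-c))) {I : Finset ℕ}
    (hI : iIndepFun (fun (s : I) => g s) P) :
    expMoment (fun ω => ∑ s ∈ I, g s ω) P ≤ ENNReal.ofReal (Real.exp (-(c * I.card))) := by
  calc expMoment (fun ω => ∑ s ∈ I, g s ω) P = ∏ s : I, expMoment (g s) P := by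
        rw [← expMoment_sum_of_iIndepFun (fun s : I => hg s) hI]
        exact congrArg (expMoment · P) (funext fun ω => (Finset.sum_coe_sort I (g · ω)).symm)
    _ ≤ ∏ _s : I, ENNReal.ofReal (Real.exp (-c)) := Finset.prod_le_prod' fun s _ => h s
    _ = ENNReal.ofReal (Real.exp (-(c * I.card))) := by
        rw [Finset.prod_const, Finset.card_univ, Fintype.card_coe,
          ← ENNReal.ofReal_pow (Real.exp_pos _).le, ← Real.exp_nat_mul]
        ring_nf

theorem iIndepFun_windows_of_modEq {β γ : Type*} [MeasurableSpace β] [MeasurableSpace γ]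
    {X : ℕ → Ω → β} (hX : ∀ t, Measurable (X t)) (hind : iIndepFun X P)
    {F : ℕ → (ℕ → β) → γ} (hF : ∀ s, Measurable (F s)) {L : ℕ}
    (hdep : ∀ s, DependsOn (F s) (Set.Ico s (s + L))) {I : Finset ℕ}
    (hI : ∀ s ∈ I, ∀ s' ∈ I, s ≡ s' [MOD L]) :
    iIndepFun (fun (s : I) ω => F s fun t => X t ω) P := by
  refine iIndepFun_of_dependsOn hX hind (fun s s' hss' => ?_) (fun s => hF s) fun s => hdep s
  refine Set.disjoint_left.2 fun t ht ht' => hss' (Subtype.ext (le_antisymm ?_ ?_))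
  · exact (hI s s.2 s' s'.2).le_of_lt_add (ht.1.trans_lt ht'.2)
  · exact (hI s' s'.2 s s.2).le_of_lt_add (ht'.1.trans_lt ht.2)

-- Jensen over the residue classes modulo `L` costs a factor `L` in the exponent but reduces to
-- independent summands.
theorem expMoment_sum_range_div_le {g : ℕ → Ω → ℝ} (hg : ∀ s, Measurable (g s)) {L T : ℕ}
    (hL : 0 < L) (hLT : L ≤ T)
    (hind : ∀ I : Finset ℕ, (∀ s ∈ I, ∀ s' ∈ I, s ≡ s' [MOD L]) →
      iIndepFun (fun (s : I) => g s) P)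
    {c : ℝ} (hc : 0 ≤ c) (h : ∀ s, expMoment (g s) P ≤ ENNReal.ofReal (Real.exp (-c))) :
    expMoment (fun ω => (∑ s ∈ Finset.range T, g s ω) / L) P
      ≤ ENNReal.ofReal (Real.exp (-(c * (T / (2 * L))))) := by
  have hL' : (L : ℝ) ≠ 0 := by positivity
  let I (j : ℕ) := (Finset.range T).filter (· ≡ j [MOD L])
  have average (ω : Ω) : (∑ s ∈ Finset.range T, g s ω) / L
      = ∑ j ∈ Finset.range L, (L : ℝ)⁻¹ * ∑ s ∈ I j, g s ω := by
    rw [sum_range_eq_sum_modEq hL, ← Finset.mul_sum, div_eq_inv_mul]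
  simp only [average]
  refine expMoment_convexComb_le _ (fun _ _ => by positivity)
    (by simp [mul_inv_cancel₀ hL']) (fun j _ => by fun_prop) fun j _ => ?_
  refine (expMoment_sum_le_exp_neg_of_iIndepFun hg h (hind (I j) fun s hs s' hs' =>
    (Finset.mem_filter.1 hs).2.trans (Finset.mem_filter.1 hs').2.symm)).trans ?_
  gcongr
  exact half_div_le_card_filter_modEq hL hLT j

end LocallyDependent

section Gaussian

theorem integral_abs_gaussianReal : ∫ x, |x| ∂(gaussianReal 0 1) = √(2 / Real.pi) := by
  have half_line : ∫ x in Set.Ioi (0 : ℝ), x * Real.exp (-(1 / 2) * x ^ 2) = 1 := by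
    have := integral_rpow_mul_exp_neg_mul_rpow (p := 2) (q := 1) (b := 1 / 2)
      (by norm_num) (by norm_num) (by norm_num)
    simp only [Real.rpow_one, Real.rpow_two] at this
    rw [this]
    norm_num [Real.rpow_neg_one]
  have density (x : ℝ) : gaussianPDFReal 0 1 x • |x|
      = (√(2 * Real.pi))⁻¹ * (|x| * Real.exp (-(1 / 2) * |x| ^ 2)) := by
    simp only [gaussianPDFReal, NNReal.coe_one, smul_eq_mul, sq_abs]
    ring_nf
  rw [integral_gaussianReal_eq_integral_smul one_ne_zero]
  simp only [density]
  rw [integral_const_mul, integral_comp_abs (f := fun x => x * Real.exp (-(1 / 2) * x ^ 2)),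
    half_line]
  rw [Real.sqrt_div' _ Real.pi_pos.le, Real.sqrt_mul' _ Real.pi_pos.le]
  field_simp
  norm_num

theorem integrable_exp_mul_abs_gaussianReal (t : ℝ) :
    Integrable (fun x => Real.exp (t * |x|)) (gaussianReal 0 1) :=
  integrable_exp_mul_abs (X := id) (integrable_exp_mul_gaussianReal t)
    (integrable_exp_mul_gaussianReal (-t))

theorem integrable_cosh_mul_gaussianReal (t : ℝ) :
    Integrable (fun x => Real.cosh (t * x)) (gaussianReal 0 1) := by
  simp only [Real.cosh_eq, ← neg_mul]
  exact ((integrable_exp_mul_gaussianReal t).add (integrable_exp_mul_gaussianReal (-t))).div_const 2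

theorem integrable_sinh_mul_abs_gaussianReal (t : ℝ) :
    Integrable (fun x => Real.sinh (t * |x|)) (gaussianReal 0 1) := by
  simp only [Real.sinh_eq, ← neg_mul]
  exact ((integrable_exp_mul_abs_gaussianReal t).sub
    (integrable_exp_mul_abs_gaussianReal (-t))).div_const 2

theorem integral_cosh_mul_gaussianReal (t : ℝ) :
    ∫ x, Real.cosh (t * x) ∂(gaussianReal 0 1) = Real.exp (t ^ 2 / 2) := by
  have mgf_eq (s : ℝ) : ∫ x, Real.exp (s * x) ∂(gaussianReal 0 1) = Real.exp (s ^ 2 / 2) := by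
    simpa [mgf] using congrFun (mgf_fun_id_gaussianReal (μ := 0) (v := 1)) s
  simp only [Real.cosh_eq, ← neg_mul]
  rw [integral_div, integral_add (integrable_exp_mul_gaussianReal _)
    (integrable_exp_mul_gaussianReal _), mgf_eq, mgf_eq, neg_sq]
  ring

theorem two_thirds_mul_le_integral_sinh_gaussianReal {t : ℝ} (ht : 0 ≤ t) :
    2 / 3 * t ≤ ∫ x, Real.sinh (t * |x|) ∂(gaussianReal 0 1) := by
  have first_moment : (2 / 3 : ℝ) ≤ ∫ x, |x| ∂(gaussianReal 0 1) := by
    rw [integral_abs_gaussianReal]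
    refine Real.le_sqrt_of_sq_le ?_
    rw [le_div_iff₀ Real.pi_pos]
    linarith [Real.pi_lt_four]
  calc 2 / 3 * t ≤ (∫ x, |x| ∂(gaussianReal 0 1)) * t := by gcongr
    _ = ∫ x, t * |x| ∂(gaussianReal 0 1) := by rw [integral_const_mul, mul_comm]
    _ ≤ ∫ x, Real.sinh (t * |x|) ∂(gaussianReal 0 1) :=
      integral_mono (((memLp_id_gaussianReal 1).integrable (by simp)).abs.const_mul t)
        (integrable_sinh_mul_abs_gaussianReal t)
        fun x => Real.self_le_sinh_iff.2 (by positivity)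

theorem exp_neg_sign_mul_eq_cosh_sub {s : ℝ} (hs : s = 1 ∨ s = -1) (y : ℝ) :
    Real.exp (-(s * y)) = Real.cosh y - s * Real.sinh y := by
  rcases hs with rfl | rfl <;> rw [Real.cosh_eq, Real.sinh_eq] <;> ring_nf

theorem exp_sq_div_two_le {t : ℝ} (ht : |t| ≤ 1) : Real.exp (t ^ 2 / 2) ≤ 1 + t ^ 2 := by
  have sq_le : t ^ 2 ≤ 1 := (sq_le_one_iff_abs_le_one t).2 ht
  have abs_half : |t ^ 2 / 2| = t ^ 2 / 2 := abs_of_nonneg (by positivity)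
  have := Real.abs_exp_sub_one_le (x := t ^ 2 / 2) (by rw [abs_half]; linarith)
  linarith [le_abs_self (Real.exp (t ^ 2 / 2) - 1)]

-- The sign has mean `θ`, which produces a drift `-θ 𝔼[sinh (t |X|)] ≤ -2θt/3`; at `t = θ/6` it
-- outweighs the quadratic growth of `𝔼[cosh (t X)] = exp (t²/2)`.
theorem expMoment_neg_sign_mul_abs_le {Ω : Type*} [MeasurableSpace Ω] {P : Measure Ω}
    [IsProbabilityMeasure P] {S X : Ω → ℝ} (hS : Measurable S) (hX : HasLaw X (gaussianReal 0 1) P)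
    (hSX : IndepFun S X P) (hS1 : ∀ ω, S ω = 1 ∨ S ω = -1) {θ : ℝ} (hθ : ∫ ω, S ω ∂P = θ)
    (hθ0 : 0 ≤ θ) :
    expMoment (fun ω => -(S ω * (θ / 6 * |X ω|))) P
      ≤ ENNReal.ofReal (Real.exp (-(θ ^ 2 / 36))) := by
  have S_bdd (ω : Ω) : ‖S ω‖ ≤ 1 := by rcases hS1 ω with h | h <;> simp [h]
  have hθ1 : θ ≤ 1 := by
    have := norm_integral_le_of_norm_le_const (μ := P) (.of_forall S_bdd)
    rw [hθ] at this
    simpa using (le_abs_self θ).trans this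
  have pull_back {f : ℝ → ℝ} (hf : Integrable f (gaussianReal 0 1)) :
      Integrable (fun ω => f (X ω)) P ∧ ∫ ω, f (X ω) ∂P = ∫ x, f x ∂(gaussianReal 0 1) :=
    ⟨(hX.map_eq ▸ hf).comp_aemeasurable hX.aemeasurable, hX.integral_comp hf.1⟩
  obtain ⟨cosh_int, cosh_eq⟩ := pull_back (integrable_cosh_mul_gaussianReal (θ / 6))
  obtain ⟨sinh_int, sinh_eq⟩ := pull_back (integrable_sinh_mul_abs_gaussianReal (θ / 6))
  have prod_int : Integrable (fun ω => S ω * Real.sinh (θ / 6 * |X ω|)) P :=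
    sinh_int.bdd_mul hS.aestronglyMeasurable (.of_forall S_bdd)
  have prod_eq : ∫ ω, S ω * Real.sinh (θ / 6 * |X ω|) ∂P
      = θ * ∫ x, Real.sinh (θ / 6 * |x|) ∂(gaussianReal 0 1) := by
    have := (hSX.comp (φ := id) (ψ := fun x => Real.sinh (θ / 6 * |x|)) measurable_id
      (by fun_prop)).integral_fun_mul_eq_mul_integral hS.aestronglyMeasurable sinh_int.1
    simp only [id_eq, Function.comp_apply] at this
    rwa [hθ, sinh_eq] at this
  have expand (ω : Ω) : Real.exp (-(S ω * (θ / 6 * |X ω|)))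
      = Real.cosh (θ / 6 * X ω) - S ω * Real.sinh (θ / 6 * |X ω|) := by
    rw [exp_neg_sign_mul_eq_cosh_sub (hS1 ω), ← Real.cosh_abs (θ / 6 * X ω), abs_mul,
      abs_of_nonneg (show 0 ≤ θ / 6 by positivity)]
  rw [expMoment_eq_ofReal_integral (by simp only [expand]; exact cosh_int.sub prod_int)]
  refine ENNReal.ofReal_le_ofReal ?_
  calc ∫ ω, Real.exp (-(S ω * (θ / 6 * |X ω|))) ∂P
      = Real.exp ((θ / 6) ^ 2 / 2) - θ * ∫ x, Real.sinh (θ / 6 * |x|) ∂(gaussianReal 0 1) := by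
        simp only [expand]
        rw [integral_sub cosh_int prod_int, cosh_eq, integral_cosh_mul_gaussianReal, prod_eq]
    _ ≤ (1 + (θ / 6) ^ 2) - θ * (2 / 3 * (θ / 6)) := by
        gcongr
        · exact exp_sq_div_two_le (abs_le.2 ⟨by linarith, by linarith⟩)
        · exact two_thirds_mul_le_integral_sinh_gaussianReal (by positivity)
    _ ≤ -(θ ^ 2 / 36) + 1 := by nlinarith [sq_nonneg θ]
    _ ≤ Real.exp (-(θ ^ 2 / 36)) := Real.add_one_le_exp _

theorem expMoment_sq_div_four_gaussianReal_le :
    expMoment (fun x => x ^ 2 / 4) (gaussianReal 0 1) ≤ 2 := by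
  have density (x : ℝ) : (gaussianPDF 0 1 * fun x => ENNReal.ofReal (Real.exp (x ^ 2 / 4))) x
      = ENNReal.ofReal ((√(2 * Real.pi))⁻¹ * Real.exp (-(1 / 4) * x ^ 2)) := by
    rw [Pi.mul_apply, gaussianPDF, ← ENNReal.ofReal_mul (gaussianPDFReal_nonneg _ _ _),
      gaussianPDFReal, mul_assoc, ← Real.exp_add]
    simp only [NNReal.coe_one, mul_one, sub_zero]
    ring_nf
  have sqrt_two : (√(2 * Real.pi))⁻¹ * √(Real.pi / (1 / 4)) = √2 := by
    rw [← Real.sqrt_inv, ← Real.sqrt_mul (by positivity)]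
    congr 1
    field_simp
    norm_num
  rw [expMoment, gaussianReal_of_var_ne_zero _ one_ne_zero,
    lintegral_withDensity_eq_lintegral_mul _ (measurable_gaussianPDF _ _) (by fun_prop)]
  simp only [density]
  rw [← ofReal_integral_eq_lintegral_ofReal
    ((integrable_exp_neg_mul_sq (by norm_num)).const_mul _) (.of_forall fun _ => by positivity),
    integral_const_mul, integral_gaussian, sqrt_two]
  exact (ENNReal.ofReal_le_ofReal (Real.sqrt_le_left (by norm_num) |>.2 (by norm_num))).trans_eq
    (ENNReal.ofReal_ofNat 2)

variable {Ω : Type*} [MeasurableSpace Ω] {P : Measure Ω}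

theorem hasLaw_inner_of_multivariateGaussian {ι : Type*} [Fintype ι] [DecidableEq ι] {γ : ℝ}
    {U : Ω → EuclideanSpace ℝ ι}
    (h : HasLaw U (multivariateGaussian 0 (γ ^ 2 • (1 : Matrix ι ι ℝ))) P)
    (v : EuclideanSpace ℝ ι) :
    HasLaw (fun ω => inner ℝ v (U ω)) (gaussianReal 0 (‖γ • v‖₊ ^ 2)) P := by
  have hU := h.aemeasurable
  have hS : (γ ^ 2 • (1 : Matrix ι ι ℝ)).PosSemidef := Matrix.PosSemidef.one.smul (sq_nonneg γ)
  have : IsProbabilityMeasure P := h.isProbabilityMeasure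
  have : IsProbabilityMeasure (P.map fun ω => inner ℝ v (U ω)) :=
    Measure.isProbabilityMeasure_map (by fun_prop)
  refine ⟨by fun_prop, Measure.ext_of_charFun (funext fun x => ?_)⟩
  calc charFun (P.map fun ω => inner ℝ v (U ω)) x
      = charFun (P.map U) (x • v) := by
        rw [charFun_apply, charFun_apply, integral_map (by fun_prop) (by fun_prop),
          integral_map hU (by fun_prop)]
        simp [inner_smul_right, real_inner_comm]
    _ = charFun (gaussianReal 0 (‖γ • v‖₊ ^ 2)) x := by
        have norm_sq : ((‖γ • v‖ : ℝ) ^ 2) = γ ^ 2 * (v.ofLp ⬝ᵥ v.ofLp) := by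
          rw [norm_smul, mul_pow, EuclideanSpace.norm_sq_eq]
          simp [dotProduct, pow_two]
        rw [h.map_eq, charFun_multivariateGaussian hS, charFun_gaussianReal]
        rw [NNReal.coe_pow, coe_nnnorm, norm_sq]
        congr 1
        simp [Matrix.smul_mulVec, dotProduct_smul, smul_dotProduct]
        ring

theorem hasLaw_sum_gaussianReal {ι : Type*} [Fintype ι] {X : ι → Ω → ℝ} (hind : iIndepFun X P)
    {μ : ι → ℝ} {v : ι → NNReal} (hX : ∀ i, HasLaw (X i) (gaussianReal (μ i) (v i)) P) :
    HasLaw (fun ω => ∑ i, X i ω) (gaussianReal (∑ i, μ i) (∑ i, v i)) P := by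
  have : IsProbabilityMeasure P := hind.isProbabilityMeasure
  have hXm (i) : AEMeasurable (X i) P := (hX i).aemeasurable
  have : IsProbabilityMeasure (P.map fun ω => ∑ i, X i ω) :=
    Measure.isProbabilityMeasure_map (by fun_prop)
  refine ⟨by fun_prop, Measure.ext_of_charFun (funext fun x => ?_)⟩
  rw [hind.charFun_map_fun_sum_eq_prod hXm, Finset.prod_apply]
  simp only [(hX _).map_eq, charFun_gaussianReal, ← Complex.exp_sum]
  push_cast
  rw [Finset.sum_sub_distrib, Finset.mul_sum, Finset.sum_mul, Finset.sum_mul, Finset.sum_div]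

end Gaussian

section SignedRegressors

variable {ι : Type*}

/-- The regression vector `(u_{s+L-1}, …, u_s)`, most recent input first, for the window of
length `L` which starts at time `s`. -/
noncomputable def regressor (L : ℕ) (u : ℕ → EuclideanSpace ℝ ι) (s : ℕ) :
    EuclideanSpace ℝ (Fin L × ι) :=
  WithLp.toLp 2 fun c => u (s + c.1.rev) c.2

theorem measurable_regressor (L s : ℕ) :
    Measurable fun u : ℕ → EuclideanSpace ℝ ι => regressor L u s := by
  unfold regressor
  fun_prop

theorem dependsOn_regressor (L s : ℕ) :
    DependsOn (fun u : ℕ → EuclideanSpace ℝ ι => regressor L u s) (Set.Ico s (s + L)) := by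
  intro u u' h
  simp only [regressor]
  congr 1 with c
  rw [h _ ⟨by lia, by have := c.1.rev.isLt; lia⟩]

/-- The sign of the window `[s, s + ℓ)`: it is `1` if no attack occurs there and `-1` otherwise. -/
noncomputable def attackSign (ℓ : ℕ) (z : ℕ → Bool) (s : ℕ) : ℝ :=
  if ∀ j ∈ Finset.Ico s (s + ℓ), z j = false then 1 else -1

theorem attackSign_eq_one_or (ℓ : ℕ) (z : ℕ → Bool) (s : ℕ) :
    attackSign ℓ z s = 1 ∨ attackSign ℓ z s = -1 := by
  unfold attackSign
  split_ifs <;> simp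

theorem dependsOn_attackSign (ℓ s : ℕ) :
    DependsOn (fun z => attackSign ℓ z s) (Set.Ico s (s + ℓ)) := by
  intro z z' h
  have : ∀ j ∈ Finset.Ico s (s + ℓ), z j = z' j := fun j hj => h j (Finset.mem_Ico.1 hj)
  simp +contextual only [attackSign, this]

theorem measurable_attackSign (ℓ s : ℕ) : Measurable fun z => attackSign ℓ z s := by
  refine Measurable.ite ?_ measurable_const measurable_const
  measurability

variable [Fintype ι]

/-- The sum of the sizes `|⟨v, U_s⟩|` with the signs `σ_s`; its positivity for every `v` is the
null space property behind `ℓ₁` recovery. -/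
noncomputable def signedSum (σ : ℕ → ℝ) (U : ℕ → EuclideanSpace ℝ ι) (T : ℕ)
    (v : EuclideanSpace ℝ ι) : ℝ :=
  ∑ s ∈ Finset.range T, σ s * |inner ℝ v (U s)|

theorem signedSum_smul (σ : ℕ → ℝ) (U : ℕ → EuclideanSpace ℝ ι) (T : ℕ) (a : ℝ)
    (v : EuclideanSpace ℝ ι) : signedSum σ U T (a • v) = |a| * signedSum σ U T v := by
  simp only [signedSum, real_inner_smul_left, abs_mul, Finset.mul_sum, mul_left_comm |a|]

theorem inner_regressor (L : ℕ) (u : ℕ → EuclideanSpace ℝ ι) (s : ℕ)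
    (v : EuclideanSpace ℝ (Fin L × ι)) :
    inner ℝ v (regressor L u s)
      = ∑ j : Fin L, inner ℝ (WithLp.toLp 2 fun i => v (j, i)) (u (s + j.rev)) := by
  simp only [PiLp.inner_apply, Fintype.sum_prod_type, regressor]

theorem sum_sq_norm_slice {κ : Type*} [Fintype κ] (v : EuclideanSpace ℝ (κ × ι)) :
    ∑ j, ‖(WithLp.toLp 2 fun i => v (j, i) : EuclideanSpace ℝ ι)‖ ^ 2 = ‖v‖ ^ 2 := by
  simp only [EuclideanSpace.norm_sq_eq, Fintype.sum_prod_type]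

variable {Ω : Type*} [MeasurableSpace Ω] {P : Measure Ω}

theorem measurable_signedSum {σ : ℕ → Ω → ℝ} (hσ : ∀ s, Measurable (σ s))
    {U : ℕ → Ω → EuclideanSpace ℝ ι} (hU : ∀ s, Measurable (U s)) (T : ℕ)
    (v : EuclideanSpace ℝ ι) :
    Measurable fun ω => signedSum (fun s => σ s ω) (fun s => U s ω) T v := by
  unfold signedSum
  fun_prop

/-- Independent Bernoulli variables with success probability `p`. -/
structure IsBernoulliSeq (ξ : ℕ → Ω → Bool) (p : ℝ) (P : Measure Ω) : Prop where
  measurable : ∀ t, Measurable (ξ t)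
  iIndepFun : iIndepFun ξ P
  measureReal_true : ∀ t, P.real {ω | ξ t ω = true} = p

theorem integral_attackSign {ξ : ℕ → Ω → Bool} {p : ℝ} (hξ : IsBernoulliSeq ξ p P) (ℓ s : ℕ) :
    ∫ ω, attackSign ℓ (fun t => ξ t ω) s ∂P = 2 * (1 - p) ^ ℓ - 1 := by
  have : IsProbabilityMeasure P := hξ.iIndepFun.isProbabilityMeasure
  let quiet : Set Ω := ⋂ t ∈ Finset.Ico s (s + ℓ), ξ t ⁻¹' {false}
  have quiet_meas : MeasurableSet quiet :=
    Finset.measurableSet_biInter _ fun t _ => hξ.measurable t (measurableSet_singleton _)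
  have prob_false (t : ℕ) : P.real (ξ t ⁻¹' {false}) = 1 - p := by
    rw [← hξ.measureReal_true t, ← probReal_compl_eq_one_sub
      (show MeasurableSet {ω | ξ t ω = true} from hξ.measurable t (measurableSet_singleton true))]
    congr 1 with ω
    simp
  have prob_quiet : P.real quiet = (1 - p) ^ ℓ := by
    rw [measureReal_def, hξ.iIndepFun.measure_inter_preimage_eq_mul _
      (fun _ _ => measurableSet_singleton _), ENNReal.toReal_prod]
    simp only [← measureReal_def, prob_false]
    simp
  have sign_eq (ω : Ω) : attackSign ℓ (fun t => ξ t ω) s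
      = 2 * quiet.indicator (fun _ => (1 : ℝ)) ω - 1 := by
    have : ω ∈ quiet ↔ ∀ t ∈ Finset.Ico s (s + ℓ), ξ t ω = false := by simp [quiet]
    by_cases h : ω ∈ quiet
    · rw [attackSign, if_pos (this.1 h), Set.indicator_of_mem h]; norm_num
    · rw [attackSign, if_neg (mt this.2 h), Set.indicator_of_notMem h]; norm_num
  simp only [sign_eq]
  rw [integral_sub (((integrable_const _).indicator quiet_meas).const_mul 2) (integrable_const _),
    integral_const_mul, integral_indicator_const _ quiet_meas, prob_quiet]
  simp

variable [DecidableEq ι]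

/-- White noise of standard deviation `γ`: independent `N(0, γ² I)` random vectors. -/
structure IsGaussianNoise (u : ℕ → Ω → EuclideanSpace ℝ ι) (γ : ℝ) (P : Measure Ω) : Prop where
  measurable : ∀ t, Measurable (u t)
  iIndepFun : iIndepFun u P
  hasLaw : ∀ t, HasLaw (u t) (multivariateGaussian 0 (γ ^ 2 • (1 : Matrix ι ι ℝ))) P

theorem hasLaw_inner_regressor {u : ℕ → Ω → EuclideanSpace ℝ ι} {γ : ℝ}
    (hu : IsGaussianNoise u γ P) (L s : ℕ) (v : EuclideanSpace ℝ (Fin L × ι)) :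
    HasLaw (fun ω => inner ℝ v (regressor L (fun t => u t ω) s))
      (gaussianReal 0 (‖γ • v‖₊ ^ 2)) P := by
  have times_inj : Function.Injective fun j : Fin L => s + (j.rev : ℕ) := fun i j h =>
    Fin.rev_injective (Fin.ext (Nat.add_left_cancel h))
  have terms := hasLaw_sum_gaussianReal
    ((hu.iIndepFun.precomp times_inj).comp
      (fun j z => inner ℝ (WithLp.toLp 2 fun i => v (j, i)) z) fun j => by fun_prop)
    fun j => hasLaw_inner_of_multivariateGaussian (hu.hasLaw _) _
  have variance_eq : ∑ j : Fin L, ‖γ • (WithLp.toLp 2 fun i => v (j, i) : EuclideanSpace ℝ ι)‖₊ ^ 2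
      = ‖γ • v‖₊ ^ 2 := by
    ext
    push_cast [coe_nnnorm, norm_smul, mul_pow]
    rw [← Finset.mul_sum, sum_sq_norm_slice]
  simp only [inner_regressor]
  rw [← variance_eq]
  simpa using terms

theorem expMoment_neg_attackSign_mul_le {u : ℕ → Ω → EuclideanSpace ℝ ι} {ξ : ℕ → Ω → Bool}
    {γ p θ : ℝ} (hu : IsGaussianNoise u γ P) (hξ : IsBernoulliSeq ξ p P)
    (huξ : IndepFun (fun ω t => u t ω) (fun ω t => ξ t ω) P) {ℓ : ℕ}
    (hθ : 2 * (1 - p) ^ ℓ - 1 = θ) (hθ0 : 0 ≤ θ) {L : ℕ} {v : EuclideanSpace ℝ (Fin L × ι)}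
    (hv : ‖γ • v‖ = 1) (s : ℕ) :
    expMoment (fun ω => -(attackSign ℓ (fun t => ξ t ω) s
        * (θ / 6 * |inner ℝ v (regressor L (fun t => u t ω) s)|))) P
      ≤ ENNReal.ofReal (Real.exp (-(θ ^ 2 / 36))) := by
  have : IsProbabilityMeasure P := hξ.iIndepFun.isProbabilityMeasure
  have law := hasLaw_inner_regressor hu L s v
  rw [show ‖γ • v‖₊ = 1 from NNReal.eq hv, one_pow] at law
  have indep := huξ.symm.comp (φ := fun z => attackSign ℓ z s)
    (ψ := fun z => inner ℝ v (regressor L z s)) (measurable_attackSign ℓ s)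
    ((measurable_const (a := v)).inner (measurable_regressor L s))
  exact expMoment_neg_sign_mul_abs_le
    ((measurable_attackSign ℓ s).comp (measurable_pi_lambda _ hξ.measurable)) law indep
    (fun ω => attackSign_eq_one_or ..) ((integral_attackSign hξ ℓ s).trans hθ) hθ0

theorem expMoment_neg_signedSum_div_le {u : ℕ → Ω → EuclideanSpace ℝ ι}
    {ξ : ℕ → Ω → Bool} {γ p θ : ℝ} (hu : IsGaussianNoise u γ P) (hξ : IsBernoulliSeq ξ p P)
    (huξ : IndepFun (fun ω t => u t ω) (fun ω t => ξ t ω) P) {ℓ L T : ℕ} (hL : 0 < L)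
    (hℓ : ℓ ≤ L) (hLT : L ≤ T) (hθ : 2 * (1 - p) ^ ℓ - 1 = θ) (hθ0 : 0 < θ)
    {v : EuclideanSpace ℝ (Fin L × ι)} (hv : ‖γ • v‖ = 1) :
    expMoment (fun ω => -(θ / 6 * signedSum (attackSign ℓ fun t => ξ t ω)
        (regressor L fun t => u t ω) T v) / L) P
      ≤ ENNReal.ofReal (Real.exp (-(θ ^ 2 / 36 * (T / (2 * L))))) := by
  let F (s : ℕ) (z : ℕ → EuclideanSpace ℝ ι × Bool) : ℝ :=
    -(attackSign ℓ (fun t => (z t).2) s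
      * (θ / 6 * |inner ℝ v (regressor L (fun t => (z t).1) s)|))
  have F_meas (s : ℕ) : Measurable (F s) := by
    have := (measurable_attackSign ℓ s).comp
      (show Measurable fun (z : ℕ → EuclideanSpace ℝ ι × Bool) t => (z t).2 by fun_prop)
    have := (measurable_regressor L s).comp
      (show Measurable fun (z : ℕ → EuclideanSpace ℝ ι × Bool) t => (z t).1 by fun_prop)
    fun_prop
  have F_dep (s : ℕ) : DependsOn (F s) (Set.Ico s (s + L)) := by
    intro z z' h
    have inputs_eq := dependsOn_regressor L s fun t ht => congrArg Prod.fst (h t ht)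
    have signs_eq := dependsOn_attackSign ℓ s fun t ht =>
      congrArg Prod.snd (h t (Set.Ico_subset_Ico_right (by lia) ht))
    simp only at inputs_eq signs_eq
    simp only [F, inputs_eq, signs_eq]
  have pair_meas (t : ℕ) : Measurable fun ω => (u t ω, ξ t ω) :=
    (hu.measurable t).prodMk (hξ.measurable t)
  have pair_indep :=
    iIndepFun_prodMk hu.measurable hξ.measurable hu.iIndepFun hξ.iIndepFun huξ
  have g_meas (s : ℕ) : Measurable fun ω => F s fun t => (u t ω, ξ t ω) :=
    (F_meas s).comp (measurable_pi_lambda _ pair_meas)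
  have sum_eq (ω : Ω) : -(θ / 6
        * signedSum (attackSign ℓ fun t => ξ t ω) (regressor L fun t => u t ω) T v)
      = ∑ s ∈ Finset.range T, F s (fun t => (u t ω, ξ t ω)) := by
    rw [signedSum, Finset.mul_sum, ← Finset.sum_neg_distrib]
    exact Finset.sum_congr rfl fun s _ => by simp only [F]; ring
  simp only [sum_eq]
  exact expMoment_sum_range_div_le g_meas hL hLT
    (fun I hI => iIndepFun_windows_of_modEq pair_meas pair_indep F_meas F_dep hI) (by positivity)
    (expMoment_neg_attackSign_mul_le hu hξ huξ hθ hθ0.le hv)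

theorem measure_signedSum_lt_le_of_norm_eq_one {u : ℕ → Ω → EuclideanSpace ℝ ι}
    {ξ : ℕ → Ω → Bool} {γ p θ : ℝ} (hu : IsGaussianNoise u γ P) (hξ : IsBernoulliSeq ξ p P)
    (huξ : IndepFun (fun ω t => u t ω) (fun ω t => ξ t ω) P) {ℓ L T : ℕ} (hL : 0 < L)
    (hℓ : ℓ ≤ L) (hLT : L ≤ T) (hθ : 2 * (1 - p) ^ ℓ - 1 = θ) (hθ0 : 0 < θ)
    {v : EuclideanSpace ℝ (Fin L × ι)} (hv : ‖γ • v‖ = 1) :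
    P {ω | signedSum (attackSign ℓ fun t => ξ t ω) (regressor L fun t => u t ω) T v < θ * T / 24}
      ≤ ENNReal.ofReal (Real.exp (-(θ ^ 2 * T / (144 * L)))) := by
  have sum_meas := measurable_signedSum
    (fun s => (measurable_attackSign ℓ s).comp (measurable_pi_lambda _ hξ.measurable))
    (fun s => (measurable_regressor L s).comp (measurable_pi_lambda _ hu.measurable)) T v
  refine (measure_mono fun ω hω => ?_).trans ((measure_lt_le_of_expMoment_le
    (s := -(θ ^ 2 * T / (144 * L))) ((sum_meas.const_mul _).neg.div_const _)
    (expMoment_neg_signedSum_div_le hu hξ huξ hL hℓ hLT hθ hθ0 hv)).trans_eq ?_)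
  · have scaled := mul_lt_mul_of_pos_left hω (show 0 < θ / 6 by positivity)
    have threshold : -(θ ^ 2 * T / (144 * L)) * L = -(θ / 6 * (θ * T / 24)) := by
      field_simp
      ring
    rw [Set.mem_ofPred_eq, lt_div_iff₀ (by positivity), threshold]
    exact neg_lt_neg scaled
  · congr 2
    field_simp
    ring

theorem measure_signedSum_lt_le {u : ℕ → Ω → EuclideanSpace ℝ ι} {ξ : ℕ → Ω → Bool} {γ p θ : ℝ}
    (hu : IsGaussianNoise u γ P) (hξ : IsBernoulliSeq ξ p P)
    (huξ : IndepFun (fun ω t => u t ω) (fun ω t => ξ t ω) P) {ℓ L T : ℕ} (hL : 0 < L)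
    (hℓ : ℓ ≤ L) (hLT : L ≤ T) (hθ : 2 * (1 - p) ^ ℓ - 1 = θ) (hθ0 : 0 < θ) (hγ : 0 < γ)
    (v : EuclideanSpace ℝ (Fin L × ι)) :
    P {ω | signedSum (attackSign ℓ fun t => ξ t ω) (regressor L fun t => u t ω) T v
        < θ * γ * T / 24 * ‖v‖}
      ≤ ENNReal.ofReal (Real.exp (-(θ ^ 2 * T / (144 * L)))) := by
  rcases eq_or_ne v 0 with rfl | hv
  · simp [signedSum]
  · have hc : 0 < (γ * ‖v‖)⁻¹ := by positivity
    refine (measure_mono fun ω hω => ?_).trans (measure_signedSum_lt_le_of_norm_eq_one hu hξ huξ hL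
      hℓ hLT hθ hθ0 (v := (γ * ‖v‖)⁻¹ • v) ?_)
    · have scaled := mul_lt_mul_of_pos_left hω hc
      rw [Set.mem_ofPred_eq, signedSum_smul, abs_of_pos hc]
      refine scaled.trans_eq ?_
      field_simp
    · rw [smul_smul, norm_smul, Real.norm_of_nonneg (by positivity)]
      field_simp

end SignedRegressors

section Rounding

variable {ι : Type*} [Fintype ι]

open Classical in
/-- The vectors with integer entries of absolute value at most `N`. Up to scaling they form a net
of the unit ball of resolution `√(card ι) / N`. -/
noncomputable def gridVectors (ι : Type*) [Fintype ι] (N : ℕ) : Finset (EuclideanSpace ℝ ι) :=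
  (Fintype.piFinset fun _ => Finset.Icc (-N : ℤ) N).image fun z => WithLp.toLp 2 fun i => (z i : ℝ)

theorem card_gridVectors_le (N : ℕ) : (gridVectors ι N).card ≤ (2 * N + 1) ^ Fintype.card ι := by
  classical
  refine Finset.card_image_le.trans_eq ?_
  rw [Fintype.card_piFinset, Finset.prod_const, Int.card_Icc, Finset.card_univ]
  congr 1
  lia

theorem exists_mem_gridVectors_norm_sub_le {N : ℕ} {x : EuclideanSpace ℝ ι} (hx : ‖x‖ ≤ N) :
    ∃ v ∈ gridVectors ι N, ‖x - v‖ ≤ √(Fintype.card ι) := by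
  classical
  have entry_le (i : ι) : |x i| ≤ N := (PiLp.norm_apply_le x i).trans hx
  refine ⟨WithLp.toLp 2 fun i => (⌊x i⌋ : ℝ), Finset.mem_image_of_mem _ <|
    Fintype.mem_piFinset.2 fun i => Finset.mem_Icc.2 ⟨Int.le_floor.2 ?_, Int.floor_le_iff.2 ?_⟩, ?_⟩
  · simpa using (abs_le.1 (entry_le i)).1
  · exact_mod_cast (abs_le.1 (entry_le i)).2.trans_lt (lt_add_one _)
  · rw [EuclideanSpace.norm_eq]
    refine Real.sqrt_le_sqrt ?_
    calc ∑ i, ‖x i - ⌊x i⌋‖ ^ 2 ≤ ∑ _i : ι, (1 : ℝ) := Finset.sum_le_sum fun i _ => by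
          rw [Int.self_sub_floor, Real.norm_of_nonneg (Int.fract_nonneg _)]
          exact pow_le_one₀ (Int.fract_nonneg _) (Int.fract_lt_one _).le
      _ = Fintype.card ι := by simp

theorem signedSum_le_add_norm_sub_mul {σ : ℕ → ℝ} (hσ : ∀ s, |σ s| ≤ 1)
    (U : ℕ → EuclideanSpace ℝ ι) (T : ℕ) (v x : EuclideanSpace ℝ ι) :
    signedSum σ U T v ≤ signedSum σ U T x + ‖x - v‖ * ∑ s ∈ Finset.range T, ‖U s‖ := by
  rw [signedSum, signedSum, Finset.mul_sum, ← Finset.sum_add_distrib]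
  refine Finset.sum_le_sum fun s _ => ?_
  have inner_close : |(|inner ℝ v (U s)| - |inner ℝ x (U s)|)| ≤ ‖x - v‖ * ‖U s‖ := by
    refine (abs_abs_sub_abs_le_abs_sub _ _).trans ?_
    rw [← inner_sub_left, ← norm_sub_rev v x]
    exact abs_real_inner_le_norm _ _
  have : |σ s * (|inner ℝ v (U s)| - |inner ℝ x (U s)|)| ≤ ‖x - v‖ * ‖U s‖ := by
    rw [abs_mul]
    exact (mul_le_of_le_one_left (abs_nonneg _) (hσ s)).trans inner_close
  linarith [le_abs_self (σ s * (|inner ℝ v (U s)| - |inner ℝ x (U s)|))]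

theorem mul_norm_le_signedSum_of_gridVectors {σ : ℕ → ℝ} (hσ : ∀ s, |σ s| ≤ 1)
    {U : ℕ → EuclideanSpace ℝ ι} {T N : ℕ} {b c : ℝ} (hc : 0 ≤ c)
    (h : ∀ v ∈ gridVectors ι N, c * ‖v‖ ≤ signedSum σ U T v)
    (hb : ∑ s ∈ Finset.range T, ‖U s‖ ≤ b) (x : EuclideanSpace ℝ ι) :
    (c * (N - √(Fintype.card ι)) - √(Fintype.card ι) * b) * ‖x‖ ≤ N * signedSum σ U T x := by
  have scaled {y : EuclideanSpace ℝ ι} (hy : ‖y‖ = N) :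
      c * (N - √(Fintype.card ι)) - √(Fintype.card ι) * b ≤ signedSum σ U T y := by
    obtain ⟨v, hv, hyv⟩ := exists_mem_gridVectors_norm_sub_le hy.le
    have norm_ge : N - √(Fintype.card ι) ≤ ‖v‖ := by linarith [norm_sub_norm_le y v]
    have error_le : ‖y - v‖ * ∑ s ∈ Finset.range T, ‖U s‖ ≤ √(Fintype.card ι) * b :=
      mul_le_mul hyv hb (Finset.sum_nonneg fun _ _ => norm_nonneg _) (Real.sqrt_nonneg _)
    have := mul_le_mul_of_nonneg_left norm_ge hc
    linarith [h v hv, signedSum_le_add_norm_sub_mul hσ U T v y]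
  rcases eq_or_ne x 0 with rfl | hx
  · simp [signedSum]
  · have hx0 : 0 < ‖x‖ := norm_pos_iff.2 hx
    have := scaled (y := ((N : ℝ) / ‖x‖) • x)
      (by rw [norm_smul, Real.norm_of_nonneg (by positivity), div_mul_cancel₀ _ hx0.ne'])
    rwa [signedSum_smul, abs_of_nonneg (by positivity), div_mul_eq_mul_div, le_div_iff₀ hx0]
      at this

theorem measure_exists_gridVectors_signedSum_lt_le {Ω : Type*} [MeasurableSpace Ω]
    {P : Measure Ω} [DecidableEq ι] {u : ℕ → Ω → EuclideanSpace ℝ ι} {ξ : ℕ → Ω → Bool}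
    {γ p θ : ℝ} (hu : IsGaussianNoise u γ P) (hξ : IsBernoulliSeq ξ p P)
    (huξ : IndepFun (fun ω t => u t ω) (fun ω t => ξ t ω) P) {ℓ L T : ℕ} (hL : 0 < L)
    (hℓ : ℓ ≤ L) (hLT : L ≤ T) (hθ : 2 * (1 - p) ^ ℓ - 1 = θ) (hθ0 : 0 < θ) (hγ : 0 < γ) (N : ℕ) :
    P {ω | ∃ v ∈ gridVectors (Fin L × ι) N,
        signedSum (attackSign ℓ fun t => ξ t ω) (regressor L fun t => u t ω) T v
          < θ * γ * T / 24 * ‖v‖}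
      ≤ ENNReal.ofReal ((2 * N + 1) ^ (L * Fintype.card ι)
          * Real.exp (-(θ ^ 2 * T / (144 * L)))) := by
  have union_eq : {ω | ∃ v ∈ gridVectors (Fin L × ι) N,
        signedSum (attackSign ℓ fun t => ξ t ω) (regressor L fun t => u t ω) T v
          < θ * γ * T / 24 * ‖v‖}
      = ⋃ v ∈ gridVectors (Fin L × ι) N,
        {ω | signedSum (attackSign ℓ fun t => ξ t ω) (regressor L fun t => u t ω) T v
          < θ * γ * T / 24 * ‖v‖} := by
    ext ω; simp
  rw [union_eq]
  calc _ ≤ ∑ v ∈ gridVectors (Fin L × ι) N,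
          P {ω | signedSum (attackSign ℓ fun t => ξ t ω) (regressor L fun t => u t ω) T v
            < θ * γ * T / 24 * ‖v‖} := measure_biUnion_finset_le _ _
    _ ≤ (gridVectors (Fin L × ι) N).card • ENNReal.ofReal (Real.exp (-(θ ^ 2 * T / (144 * L)))) :=
        Finset.sum_le_card_nsmul _ _ _ fun v _ =>
          measure_signedSum_lt_le hu hξ huξ hL hℓ hLT hθ hθ0 hγ v
    _ ≤ ((2 * N + 1) ^ (L * Fintype.card ι) : ℕ)
          * ENNReal.ofReal (Real.exp (-(θ ^ 2 * T / (144 * L)))) := by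
        rw [nsmul_eq_mul]
        gcongr
        simpa using card_gridVectors_le (ι := Fin L × ι) N
    _ = _ := by
        rw [ENNReal.ofReal_mul (by positivity), ← ENNReal.ofReal_natCast]
        push_cast
        rfl

end Rounding

section InputEnergy

theorem sum_norm_le_of_sum_sq_norm_le {E : Type*} [SeminormedAddCommGroup E] {z : ℕ → E} {T : ℕ}
    {b : ℝ} (hb : 0 ≤ b) (h : ∑ s ∈ Finset.range T, ‖z s‖ ^ 2 ≤ b ^ 2 * T) :
    ∑ s ∈ Finset.range T, ‖z s‖ ≤ b * T := by
  refine (sq_le_sq₀ (by positivity) (by positivity)).1 ?_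
  calc (∑ s ∈ Finset.range T, ‖z s‖) ^ 2 ≤ T * ∑ s ∈ Finset.range T, ‖z s‖ ^ 2 := by
        simpa using sq_sum_le_card_mul_sum_sq (s := Finset.range T) (f := (‖z ·‖))
    _ ≤ T * (b ^ 2 * T) := by gcongr
    _ = (b * T) ^ 2 := by ring

variable {Ω ι : Type*} [MeasurableSpace Ω] {P : Measure Ω} [Fintype ι]

theorem sum_sq_norm_regressor_le (L T : ℕ) (u : ℕ → EuclideanSpace ℝ ι) :
    ∑ s ∈ Finset.range T, ‖regressor L u s‖ ^ 2
      ≤ L * ∑ t ∈ Finset.range (T + L - 1), ‖u t‖ ^ 2 := by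
  have norm_sq (s : ℕ) : ‖regressor L u s‖ ^ 2 = ∑ j : Fin L, ‖u (s + j.rev)‖ ^ 2 :=
    (sum_sq_norm_slice _).symm
  simp only [norm_sq]
  rw [Finset.sum_comm]
  calc ∑ j : Fin L, ∑ s ∈ Finset.range T, ‖u (s + j.rev)‖ ^ 2
      ≤ ∑ _j : Fin L, ∑ t ∈ Finset.range (T + L - 1), ‖u t‖ ^ 2 := by
        refine Finset.sum_le_sum fun j _ => ?_
        rw [← Finset.sum_image (f := fun t => ‖u t‖ ^ 2) (add_left_injective (j.rev : ℕ)).injOn]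
        refine Finset.sum_le_sum_of_subset_of_nonneg (Finset.image_subset_iff.2 fun s hs => ?_)
          fun _ _ _ => by positivity
        have := j.rev.isLt
        exact Finset.mem_range.2 (by have := Finset.mem_range.1 hs; lia)
    _ = L * ∑ t ∈ Finset.range (T + L - 1), ‖u t‖ ^ 2 := by simp

theorem sum_norm_regressor_le {L T : ℕ} {u : ℕ → EuclideanSpace ℝ ι} {γ : ℝ} (hγ : 0 ≤ γ)
    (hE : ∑ t ∈ Finset.range (T + L - 1), ‖u t‖ ^ 2 ≤ 12 * Fintype.card ι * γ ^ 2 * T) :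
    ∑ s ∈ Finset.range T, ‖regressor L u s‖ ≤ 4 * √(L * Fintype.card ι) * γ * T := by
  refine sum_norm_le_of_sum_sq_norm_le (by positivity) ?_
  calc ∑ s ∈ Finset.range T, ‖regressor L u s‖ ^ 2
      ≤ L * (12 * Fintype.card ι * γ ^ 2 * T) :=
        (sum_sq_norm_regressor_le L T u).trans (by gcongr)
    _ = 12 * (L * Fintype.card ι * γ ^ 2 * T) := by ring
    _ ≤ 16 * (L * Fintype.card ι * γ ^ 2 * T) := by gcongr; norm_num
    _ = (4 * √(L * Fintype.card ι) * γ) ^ 2 * T := by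
        rw [mul_pow, mul_pow, Real.sq_sqrt (by positivity)]
        ring

theorem mul_norm_le_signedSum_of_energy_le [Nonempty ι] {L T N : ℕ} (hL : 0 < L) {θ γ : ℝ}
    (hθ0 : 0 < θ) (hθ1 : θ ≤ 1) (hγ : 0 ≤ γ) {u : ℕ → EuclideanSpace ℝ ι} {σ : ℕ → ℝ}
    (hσ : ∀ s, |σ s| ≤ 1)
    (hE : ∑ t ∈ Finset.range (T + L - 1), ‖u t‖ ^ 2 ≤ 12 * Fintype.card ι * γ ^ 2 * T)
    (hN : 130 * (L * Fintype.card ι) ≤ N * θ)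
    (h : ∀ v ∈ gridVectors (Fin L × ι) N,
      θ * γ * T / 24 * ‖v‖ ≤ signedSum σ (regressor L u) T v)
    (x : EuclideanSpace ℝ (Fin L × ι)) :
    θ * γ * T / 96 * ‖x‖ ≤ signedSum σ (regressor L u) T x := by
  have rounded := mul_norm_le_signedSum_of_gridVectors hσ (by positivity) h
    (sum_norm_regressor_le hγ hE) x
  rw [Fintype.card_prod, Fintype.card_fin, Nat.cast_mul] at rounded
  have hd : (1 : ℝ) ≤ L * Fintype.card ι := by
    exact_mod_cast Nat.mul_pos hL (Fintype.card_pos (α := ι))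
  set d : ℝ := L * Fintype.card ι
  have hN0 : (0 : ℝ) < N := pos_of_mul_pos_left (by linarith) hθ0.le
  have sqrt_sq : √d * √d = d := Real.mul_self_sqrt (by linarith)
  have sqrt_le : θ * √d ≤ d :=
    (mul_le_of_le_one_left (Real.sqrt_nonneg d) hθ1).trans (Real.sqrt_le_self_iff.2 (.inr hd))
  refine le_of_mul_le_mul_left (le_trans ?_ rounded) hN0
  calc N * (θ * γ * T / 96 * ‖x‖) = N * θ / 96 * (γ * T) * ‖x‖ := by ring
    _ ≤ (N * θ / 24 - θ * √d / 24 - 4 * (√d * √d)) * (γ * T) * ‖x‖ := by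
        gcongr
        linarith
    _ = _ := by ring

variable [DecidableEq ι]

theorem hasLaw_apply_div_gaussianReal {U : Ω → EuclideanSpace ℝ ι} {γ : ℝ} (hγ : γ ≠ 0)
    (h : HasLaw U (multivariateGaussian 0 (γ ^ 2 • (1 : Matrix ι ι ℝ))) P) (i : ι) :
    HasLaw (fun ω => U ω i / γ) (gaussianReal 0 1) P := by
  have unit : ‖γ • EuclideanSpace.single i γ⁻¹‖₊ = 1 := by
    rw [nnnorm_smul, PiLp.nnnorm_single, ← nnnorm_mul, mul_inv_cancel₀ hγ, nnnorm_one]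
  have := hasLaw_inner_of_multivariateGaussian h (EuclideanSpace.single i γ⁻¹)
  rw [unit, one_pow] at this
  simpa [EuclideanSpace.inner_single_left, div_eq_inv_mul] using this

theorem expMoment_sq_norm_div_le [Nonempty ι] {U : Ω → EuclideanSpace ℝ ι} (hU : Measurable U)
    {γ : ℝ} (hγ : γ ≠ 0) (h : HasLaw U (multivariateGaussian 0 (γ ^ 2 • (1 : Matrix ι ι ℝ))) P) :
    expMoment (fun ω => ‖U ω‖ ^ 2 / (4 * Fintype.card ι * γ ^ 2)) P ≤ 2 := by
  have hcard : (Fintype.card ι : ℝ) ≠ 0 := by simp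
  have average (ω : Ω) : ‖U ω‖ ^ 2 / (4 * Fintype.card ι * γ ^ 2)
      = ∑ i, (Fintype.card ι : ℝ)⁻¹ * ((U ω i / γ) ^ 2 / 4) := by
    simp only [EuclideanSpace.real_norm_sq_eq, ← Finset.mul_sum, div_pow, ← Finset.sum_div]
    field_simp
  simp only [average]
  refine expMoment_convexComb_le _ (fun _ _ => by positivity) (by simp [hcard])
    (fun i _ => by fun_prop) fun i _ => ?_
  refine (expMoment_comp (f := fun x => x ^ 2 / 4) (show Measurable fun ω => U ω i / γ by fun_prop)
    (by fun_prop)).trans_le ?_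
  rw [(hasLaw_apply_div_gaussianReal hγ h i).map_eq]
  exact expMoment_sq_div_four_gaussianReal_le

theorem measure_energy_gt_le [Nonempty ι] {u : ℕ → Ω → EuclideanSpace ℝ ι} {γ : ℝ}
    (hu : IsGaussianNoise u γ P) (hγ : γ ≠ 0) {n T : ℕ} (hn : n ≤ 2 * T) :
    P {ω | 12 * Fintype.card ι * γ ^ 2 * T < ∑ t ∈ Finset.range n, ‖u t ω‖ ^ 2}
      ≤ ENNReal.ofReal (Real.exp (-T)) := by
  let a : ℝ := 4 * Fintype.card ι * γ ^ 2
  have ha : 0 < a := by positivity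
  have hmeas := hu.measurable
  have two_eq : (2 : ℝ≥0∞) = ENNReal.ofReal (Real.exp (-(-Real.log 2))) := by
    rw [neg_neg, Real.exp_log two_pos, ENNReal.ofReal_ofNat]
  have moment := expMoment_sum_le_exp_neg_of_iIndepFun (g := fun t ω => ‖u t ω‖ ^ 2 / a)
    (fun t => by fun_prop)
    (fun t => (expMoment_sq_norm_div_le (hmeas t) hγ (hu.hasLaw t)).trans_eq two_eq)
    (I := Finset.range n)
    ((hu.iIndepFun.comp (fun _ z => ‖z‖ ^ 2 / a) fun _ => by fun_prop).precomp
      Subtype.val_injective)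
  refine (measure_mono fun ω hω => ?_).trans ((measure_lt_le_of_expMoment_le (s := 3 * T)
    (by fun_prop) (moment.trans_eq (by rw [Finset.card_range]))).trans ?_)
  · rw [Set.mem_ofPred_eq, ← Finset.sum_div, lt_div_iff₀ ha]
    calc 3 * T * a = 12 * Fintype.card ι * γ ^ 2 * T := by ring
      _ < _ := hω
  · gcongr
    have : (n : ℝ) ≤ 2 * T := by exact_mod_cast hn
    have : Real.log 2 * n ≤ 1 * n := by gcongr; linarith [Real.log_two_lt_d9]
    linarith

end InputEnergy

section SubGaussianNorm

variable {Ω : Type*} [MeasurableSpace Ω] {P : Measure Ω} {d : ℕ}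

theorem expMoment_sq_div_le_of_psi2Norm_lt {X : Ω → ℝ} {c : ℝ}
    (h : psi2Norm X P < ENNReal.ofReal c) : expMoment (fun ω => X ω ^ 2 / c ^ 2) P ≤ 2 := by
  simp only [psi2Norm, iInf_lt_iff] at h
  obtain ⟨b, hb, hXb, hbc⟩ := h
  have : b < c := (ENNReal.ofReal_lt_ofReal_iff_of_nonneg hb.le).1 hbc
  exact (expMoment_mono fun ω => by gcongr).trans hXb

theorem expMoment_sq_inner_div_le_of_vecPsi2Norm_lt {W : Ω → EuclideanSpace ℝ (Fin d)} {c : ℝ}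
    (h : vecPsi2Norm W P < ENNReal.ofReal c) {v : EuclideanSpace ℝ (Fin d)} (hv : ‖v‖ ≤ 1) :
    expMoment (fun ω => inner ℝ (W ω) v ^ 2 / c ^ 2) P ≤ 2 :=
  expMoment_sq_div_le_of_psi2Norm_lt <| lt_of_le_of_lt
    (le_iSup₂ (f := fun v (_ : ‖v‖ ≤ 1) => psi2Norm (fun ω => inner ℝ (W ω) v) P) v hv) h

theorem exists_sq_norm_apply_eq_sum_sq_inner {E ι : Type*} [NormedAddCommGroup E]
    [InnerProductSpace ℝ E] [CompleteSpace E] [Fintype ι] (M : E →L[ℝ] EuclideanSpace ℝ ι) :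
    ∃ φ : ι → E, (∀ i, ‖φ i‖ ≤ 1) ∧ ∀ z, ‖M z‖ ^ 2 = ‖M‖ ^ 2 * ∑ i, inner ℝ z (φ i) ^ 2 := by
  classical
  let row (i : ι) : E := M.adjoint (EuclideanSpace.single i 1)
  have norm_row_le (i : ι) : ‖row i‖ ≤ ‖M‖ := by
    simpa using M.adjoint.le_opNorm (EuclideanSpace.single i 1)
  refine ⟨fun i => ‖M‖⁻¹ • row i, fun i => ?_, fun z => ?_⟩
  · rw [norm_smul, norm_inv, norm_norm]
    exact inv_mul_le_one_of_le₀ (norm_row_le i) (norm_nonneg M)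
  · rcases eq_or_ne M 0 with rfl | hM
    · simp
    have : ‖M‖ ≠ 0 := norm_ne_zero_iff.2 hM
    rw [EuclideanSpace.real_norm_sq_eq, Finset.mul_sum]
    refine Finset.sum_congr rfl fun i _ => ?_
    have : inner ℝ z (row i) = M z i := by
      simp [row, ContinuousLinearMap.adjoint_inner_right, EuclideanSpace.inner_single_right]
    rw [inner_smul_right, this]
    field_simp

variable [IsProbabilityMeasure P]

theorem expMoment_sq_sum_norm_div_le {ι κ : Type*} [Fintype ι]
    {W : Ω → EuclideanSpace ℝ (Fin d)} (hW : Measurable W) {c : ℝ}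
    (h : vecPsi2Norm W P < ENNReal.ofReal c) (J : Finset κ)
    (M : κ → EuclideanSpace ℝ (Fin d) →L[ℝ] EuclideanSpace ℝ ι) :
    expMoment (fun ω => (∑ j ∈ J, ‖M j (W ω)‖) ^ 2
      / (Fintype.card ι * ((∑ j ∈ J, ‖M j‖) * c) ^ 2)) P ≤ 2 := by
  set K := ∑ j ∈ J, ‖M j‖ with hK
  rcases eq_or_ne (Fintype.card ι * K) 0 with h0 | h0
  · have : Fintype.card ι * (K * c) ^ 2 = 0 := by
      rw [mul_pow, sq K, mul_assoc, ← mul_assoc, h0, zero_mul]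
    simp [this, expMoment]
  have hcard : (Fintype.card ι : ℝ) ≠ 0 := left_ne_zero_of_mul h0
  have hK0 : K ≠ 0 := right_ne_zero_of_mul h0
  have : 0 ≤ K := Finset.sum_nonneg fun _ _ => norm_nonneg _
  choose φ hφ norm_sq using fun j => exists_sq_norm_apply_eq_sum_sq_inner (M j)
  have cauchy_schwarz (z : EuclideanSpace ℝ (Fin d)) : (∑ j ∈ J, ‖M j z‖) ^ 2
      ≤ K * ∑ j ∈ J, ‖M j‖ * ∑ i, inner ℝ z (φ j i) ^ 2 :=
    Finset.sum_sq_le_sum_mul_sum_of_sq_le_mul J (fun _ _ => norm_nonneg _)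
      (fun _ _ => by positivity) fun j _ => by rw [norm_sq, sq ‖M j‖, mul_assoc]
  have average (ω : Ω) : (∑ j ∈ J, ‖M j (W ω)‖) ^ 2 / (Fintype.card ι * (K * c) ^ 2)
      ≤ ∑ a ∈ J ×ˢ (Finset.univ : Finset ι),
        ‖M a.1‖ / (K * Fintype.card ι) * (inner ℝ (W ω) (φ a.1 a.2) ^ 2 / c ^ 2) := by
    calc (∑ j ∈ J, ‖M j (W ω)‖) ^ 2 / (Fintype.card ι * (K * c) ^ 2)
        ≤ K * (∑ j ∈ J, ‖M j‖ * ∑ i, inner ℝ (W ω) (φ j i) ^ 2)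
          / (Fintype.card ι * (K * c) ^ 2) := by gcongr; exact cauchy_schwarz _
      _ = ∑ j ∈ J, ‖M j‖ / (K * Fintype.card ι) * (∑ i, inner ℝ (W ω) (φ j i) ^ 2 / c ^ 2) := by
          rw [Finset.mul_sum, Finset.sum_div]
          refine Finset.sum_congr rfl fun j _ => ?_
          rw [← Finset.sum_div]
          field_simp
      _ = _ := by simp only [Finset.sum_product, Finset.mul_sum]
  refine (expMoment_mono average).trans (expMoment_convexComb_le _ (fun _ _ => by positivity) ?_
    (fun _ _ => by fun_prop)
    fun a _ => expMoment_sq_inner_div_le_of_vecPsi2Norm_lt h (hφ a.1 a.2))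
  simp only [Finset.sum_product, Finset.sum_const, Finset.card_univ, nsmul_eq_mul]
  rw [← Finset.mul_sum, ← Finset.sum_div, ← hK]
  field_simp

variable {x₀ : Ω → EuclideanSpace ℝ (Fin d)} {w : ℕ → Ω → EuclideanSpace ℝ (Fin d)}

theorem expMoment_add_sum_le_pow_of_condDistrib (hx : Measurable x₀) (hw : ∀ t, Measurable (w t))
    {f : EuclideanSpace ℝ (Fin d) → ℝ} (hf : Measurable f) {K : ℝ≥0∞}
    (h₀ : expMoment (fun ω => f (x₀ ω)) P ≤ K)
    (h : ∀ t, ∀ᵐ h ∂(P.map (history x₀ w t)),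
      expMoment f (condDistrib (w t) (history x₀ w t) P h) ≤ K) (T : ℕ) :
    expMoment (fun ω => f (x₀ ω) + ∑ s ∈ Finset.range T, f (w s ω)) P ≤ K ^ (T + 1) := by
  induction T with
  | zero => simpa using h₀
  | succ T ih =>
    have hH : Measurable (history x₀ w T) := hx.prodMk (measurable_pi_lambda _ fun s => hw s)
    let past (a : EuclideanSpace ℝ (Fin d) × (Fin T → EuclideanSpace ℝ (Fin d))) : ℝ :=
      f a.1 + ∑ s, f (a.2 s)
    have hpast : Measurable past := by fun_prop
    have past_history (ω : Ω) : past (history x₀ w T ω)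
        = f (x₀ ω) + ∑ s ∈ Finset.range T, f (w s ω) := by
      simp only [past, history, Fin.sum_univ_eq_sum_range fun s => f (w s ω)]
    calc expMoment (fun ω => f (x₀ ω) + ∑ s ∈ Finset.range (T + 1), f (w s ω)) P
        = expMoment (fun ω => past (history x₀ w T ω) + f (w T ω)) P := by
          simp only [past_history, Finset.sum_range_succ, add_assoc]
      _ = expMoment (fun z => past z.1 + f z.2) (P.map fun ω => (history x₀ w T ω, w T ω)) :=
          expMoment_comp (f := fun z => past z.1 + f z.2) (hH.prodMk (hw T)) (by fun_prop)
      _ = ∫⁻ a, ENNReal.ofReal (Real.exp (past a))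
            * expMoment f (condDistrib (w T) (history x₀ w T) P a) ∂(P.map (history x₀ w T)) := by
          rw [← compProd_map_condDistrib (hw T).aemeasurable, expMoment,
            Measure.lintegral_compProd (by fun_prop)]
          refine lintegral_congr fun a => ?_
          simp only [Real.exp_add, ENNReal.ofReal_mul (Real.exp_pos _).le]
          exact lintegral_const_mul (f := fun z => ENNReal.ofReal (Real.exp (f z))) _ (by fun_prop)
      _ ≤ ∫⁻ a, ENNReal.ofReal (Real.exp (past a)) * K ∂(P.map (history x₀ w T)) :=
          lintegral_mono_ae ((h T).mono fun a ha => by gcongr)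
      _ = expMoment (fun ω => f (x₀ ω) + ∑ s ∈ Finset.range T, f (w s ω)) P * K := by
          rw [lintegral_mul_const _ (by fun_prop)]
          simp only [← past_history]
          rw [expMoment_comp hH hpast, expMoment]
      _ ≤ K ^ (T + 1) * K := by gcongr
      _ = K ^ (T + 1 + 1) := (pow_succ _ _).symm

theorem measure_lt_add_sum_le_of_condDistrib (hx : Measurable x₀) (hw : ∀ t, Measurable (w t))
    {N : EuclideanSpace ℝ (Fin d) → ℝ} (hN : Measurable N) {c : ℝ} (hc : 0 < c)
    (h₀ : expMoment (fun ω => N (x₀ ω) ^ 2 / c ^ 2) P ≤ 2)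
    (h : ∀ t, ∀ᵐ h ∂(P.map (history x₀ w t)),
      expMoment (fun z => N z ^ 2 / c ^ 2) (condDistrib (w t) (history x₀ w t) P h) ≤ 2)
    {T : ℕ} (hT : 1 ≤ T) :
    P {ω | 5 / 2 * c * T < N (x₀ ω) + ∑ s ∈ Finset.range T, N (w s ω)}
      ≤ ENNReal.ofReal (Real.exp (-T)) := by
  have young (z : EuclideanSpace ℝ (Fin d)) : N z ≤ c / 2 * (N z ^ 2 / c ^ 2 + 1) := by
    have := mul_nonneg hc.le (sq_nonneg (N z / c - 1))
    have : c * (N z / c - 1) ^ 2 = 2 * (c / 2 * (N z ^ 2 / c ^ 2 + 1)) - 2 * N z := by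
      field_simp
      ring
    linarith
  have hT' : (1 : ℝ) ≤ T := by exact_mod_cast hT
  have two_pow : (2 : ℝ≥0∞) ^ (T + 1) = ENNReal.ofReal (Real.exp ((T + 1) * Real.log 2)) := by
    rw [← Nat.cast_succ, Real.exp_nat_mul, Real.exp_log two_pos, ENNReal.ofReal_pow two_pos.le,
      ENNReal.ofReal_ofNat]
  have moment := expMoment_add_sum_le_pow_of_condDistrib hx hw
    (f := fun z => N z ^ 2 / c ^ 2) (by fun_prop) h₀ h T
  refine (measure_mono fun ω hω => ?_).trans ((measure_lt_le_of_expMoment_le (s := 4 * T - 1)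
    (by fun_prop) (moment.trans_eq two_pow)).trans ?_)
  · have bound : N (x₀ ω) + ∑ s ∈ Finset.range T, N (w s ω) ≤ c / 2
        * (N (x₀ ω) ^ 2 / c ^ 2 + ∑ s ∈ Finset.range T, N (w s ω) ^ 2 / c ^ 2 + (T + 1)) := by
      calc _ ≤ c / 2 * (N (x₀ ω) ^ 2 / c ^ 2 + 1)
            + ∑ s ∈ Finset.range T, c / 2 * (N (w s ω) ^ 2 / c ^ 2 + 1) := by
            gcongr <;> exact young _
        _ = _ := by
            rw [← Finset.mul_sum, Finset.sum_add_distrib, Finset.sum_const, Finset.card_range,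
              nsmul_one]
            ring
    have : c / 2 * (5 * T) < c / 2
        * (N (x₀ ω) ^ 2 / c ^ 2 + ∑ s ∈ Finset.range T, N (w s ω) ^ 2 / c ^ 2 + (T + 1)) := by
      refine lt_of_lt_of_le ?_ bound
      rw [Set.mem_ofPred_eq] at hω
      linarith
    rw [Set.mem_ofPred_eq]
    linarith [lt_of_mul_lt_mul_left this (by positivity)]
  · gcongr
    have : (T + 1) * Real.log 2 ≤ (T + 1) * 0.7 := by gcongr; linarith [Real.log_two_lt_d9]
    linarith

/-- An initial state `x₀` and attacks `w` of sub-Gaussian norm at most `η`, where the norm of each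
attack is conditional on the initial state and the previous attacks. -/
structure IsSubGaussianAttack (x₀ : Ω → EuclideanSpace ℝ (Fin d))
    (w : ℕ → Ω → EuclideanSpace ℝ (Fin d)) (η : ℝ) (P : Measure Ω) [IsFiniteMeasure P] :
    Prop where
  measurable_init : Measurable x₀
  measurable : ∀ t, Measurable (w t)
  vecPsi2Norm_init_le : vecPsi2Norm x₀ P ≤ ENNReal.ofReal η
  condPsi2Le : ∀ t, CondPsi2Le P (w t) (history x₀ w t) η

theorem measure_lt_sum_norm_history_le {ι κ : Type*} [Fintype ι] {η : ℝ}
    (hw : IsSubGaussianAttack x₀ w η P) (hη : 0 < η) (J : Finset κ)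
    (M : κ → EuclideanSpace ℝ (Fin d) →L[ℝ] EuclideanSpace ℝ ι) {T : ℕ} (hT : 1 ≤ T) :
    P {ω | 5 * √(Fintype.card ι) * (∑ j ∈ J, ‖M j‖) * η * T
        < ∑ j ∈ J, ‖M j (x₀ ω)‖ + ∑ s ∈ Finset.range T, ∑ j ∈ J, ‖M j (w s ω)‖}
      ≤ ENNReal.ofReal (Real.exp (-T)) := by
  have lt_two_mul : ENNReal.ofReal η < ENNReal.ofReal (2 * η) :=
    (ENNReal.ofReal_lt_ofReal_iff (by positivity)).2 (by linarith)
  by_cases hM : ∀ j ∈ J, M j = 0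
  · have response_eq_zero (z : EuclideanSpace ℝ (Fin d)) : ∑ j ∈ J, ‖M j z‖ = 0 :=
      Finset.sum_eq_zero fun j hj => by simp [hM j hj]
    have norm_eq_zero : ∑ j ∈ J, ‖M j‖ = 0 := Finset.sum_eq_zero fun j hj => by simp [hM j hj]
    simp [response_eq_zero, norm_eq_zero]
  push Not at hM
  obtain ⟨j, hj, hMj⟩ := hM
  have : Nonempty ι := by
    by_contra hι
    rw [not_nonempty_iff] at hι
    exact hMj (Subsingleton.elim _ _)
  set K := ∑ j ∈ J, ‖M j‖
  have hK : 0 < K := (norm_pos_iff.2 hMj).trans_le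
    (Finset.single_le_sum (fun i _ => norm_nonneg (M i)) hj)
  have sq_scale : (√(Fintype.card ι) * (K * (2 * η))) ^ 2
      = Fintype.card ι * (K * (2 * η)) ^ 2 := by
    rw [mul_pow, Real.sq_sqrt (by positivity)]
  have := measure_lt_add_sum_le_of_condDistrib (N := fun z => ∑ j ∈ J, ‖M j z‖)
    hw.measurable_init hw.measurable (by fun_prop) (c := √(Fintype.card ι) * (K * (2 * η)))
    (by positivity)
    (sq_scale ▸ expMoment_sq_sum_norm_div_le hw.measurable_init
      (hw.vecPsi2Norm_init_le.trans_lt lt_two_mul) J M)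
    (fun t => (hw.condPsi2Le t).mono fun _ h => sq_scale ▸
      expMoment_sq_sum_norm_div_le measurable_id (h.trans_lt lt_two_mul) J M) hT
  convert this using 5
  ring

end SubGaussianNorm

section LinearResponse

variable {E F : Type*} [NormedAddCommGroup E] [NormedSpace ℝ E] [NormedAddCommGroup F]
  [NormedSpace ℝ F] (A : E →L[ℝ] E) (M : E →L[ℝ] F)

theorem norm_comp_pow_le (j : ℕ) : ‖M ∘L A ^ j‖ ≤ ‖M‖ * ‖A‖ ^ j := by
  induction j with
  | zero => simp [ContinuousLinearMap.one_def]
  | succ j ih =>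
    calc ‖M ∘L A ^ (j + 1)‖ = ‖(M ∘L A ^ j) ∘L A‖ := by rw [pow_succ]; rfl
      _ ≤ ‖M ∘L A ^ j‖ * ‖A‖ := ContinuousLinearMap.opNorm_comp_le _ _
      _ ≤ ‖M‖ * ‖A‖ ^ j * ‖A‖ := by gcongr
      _ = ‖M‖ * ‖A‖ ^ (j + 1) := by rw [mul_assoc, pow_succ]

theorem sum_norm_comp_pow_le (hA : ‖A‖ < 1) (J : ℕ) :
    ∑ j ∈ Finset.range J, ‖M ∘L A ^ j‖ ≤ ‖M‖ / (1 - ‖A‖) :=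
  calc ∑ j ∈ Finset.range J, ‖M ∘L A ^ j‖ ≤ ∑ j ∈ Finset.range J, ‖M‖ * ‖A‖ ^ j :=
        Finset.sum_le_sum fun j _ => norm_comp_pow_le A M j
    _ = ‖M‖ * ∑ j ∈ Finset.range J, ‖A‖ ^ j := (Finset.mul_sum _ _ _).symm
    _ ≤ ‖M‖ * ∑' j : ℕ, ‖A‖ ^ j := by
        gcongr
        exact (summable_geometric_of_lt_one (norm_nonneg A) hA).sum_le_tsum _
          fun _ _ => by positivity
    _ = ‖M‖ / (1 - ‖A‖) := by
        rw [tsum_geometric_of_lt_one (norm_nonneg A) hA, div_eq_mul_inv]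

-- The second sum on the left, the future response to the state at time `T`, makes the induction
-- on `T` go through.
theorem sum_norm_recursion_add_le {x v : ℕ → E} (hx : ∀ t, x (t + 1) = A (x t) + v t) (T J : ℕ) :
    ∑ t ∈ Finset.range T, ‖M (x t)‖ + ∑ j ∈ Finset.range J, ‖(M ∘L A ^ j) (x T)‖
      ≤ ∑ j ∈ Finset.range (J + T), ‖(M ∘L A ^ j) (x 0)‖
        + ∑ s ∈ Finset.range T, ∑ j ∈ Finset.range (J + T), ‖(M ∘L A ^ j) (v s)‖ := by
  induction T generalizing J with
  | zero => simp
  | succ T ih =>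
    have step (j : ℕ) : ‖(M ∘L A ^ j) (x (T + 1))‖
        ≤ ‖(M ∘L A ^ (j + 1)) (x T)‖ + ‖(M ∘L A ^ j) (v T)‖ := by
      rw [hx, map_add, pow_succ]
      exact norm_add_le _ _
    calc ∑ t ∈ Finset.range (T + 1), ‖M (x t)‖ + ∑ j ∈ Finset.range J, ‖(M ∘L A ^ j) (x (T + 1))‖
        ≤ ∑ t ∈ Finset.range (T + 1), ‖M (x t)‖ + ∑ j ∈ Finset.range J,
          (‖(M ∘L A ^ (j + 1)) (x T)‖ + ‖(M ∘L A ^ j) (v T)‖) := by gcongr; exact step _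
      _ = ∑ t ∈ Finset.range T, ‖M (x t)‖ + ∑ j ∈ Finset.range (J + 1), ‖(M ∘L A ^ j) (x T)‖
          + ∑ j ∈ Finset.range J, ‖(M ∘L A ^ j) (v T)‖ := by
        rw [Finset.sum_range_succ, Finset.sum_range_succ' _ J, Finset.sum_add_distrib]
        simp only [pow_zero, ContinuousLinearMap.one_def, ContinuousLinearMap.comp_id]
        ring
      _ ≤ ∑ j ∈ Finset.range (J + 1 + T), ‖(M ∘L A ^ j) (x 0)‖
          + ∑ s ∈ Finset.range T, ∑ j ∈ Finset.range (J + 1 + T), ‖(M ∘L A ^ j) (v s)‖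
          + ∑ j ∈ Finset.range (J + 1 + T), ‖(M ∘L A ^ j) (v T)‖ :=
        add_le_add (ih (J + 1)) (Finset.sum_le_sum_of_subset_of_nonneg
          (Finset.range_mono (by lia)) fun _ _ _ => norm_nonneg _)
      _ = _ := by rw [Finset.sum_range_succ _ T, add_assoc, show J + 1 + T = J + (T + 1) by lia]

theorem sum_norm_recursion_le {U : Type*} [NormedAddCommGroup U] [NormedSpace ℝ U]
    (hA : ‖A‖ < 1) (B : U →L[ℝ] E) {x w : ℕ → E} {u : ℕ → U}
    (hx : ∀ t, x (t + 1) = A (x t) + B (u t) + w t) (T : ℕ) :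
    ∑ t ∈ Finset.range T, ‖M (x t)‖
      ≤ ‖M‖ / (1 - ‖A‖) * ‖B‖ * ∑ t ∈ Finset.range T, ‖u t‖
        + (∑ j ∈ Finset.range T, ‖(M ∘L A ^ j) (x 0)‖
          + ∑ s ∈ Finset.range T, ∑ j ∈ Finset.range T, ‖(M ∘L A ^ j) (w s)‖) := by
  have input_response (s : ℕ) : ∑ j ∈ Finset.range T, ‖(M ∘L A ^ j) (B (u s) + w s)‖
      ≤ ‖M‖ / (1 - ‖A‖) * ‖B‖ * ‖u s‖ + ∑ j ∈ Finset.range T, ‖(M ∘L A ^ j) (w s)‖ := by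
    calc ∑ j ∈ Finset.range T, ‖(M ∘L A ^ j) (B (u s) + w s)‖
        ≤ ∑ j ∈ Finset.range T, (‖M ∘L A ^ j‖ * (‖B‖ * ‖u s‖) + ‖(M ∘L A ^ j) (w s)‖) := by
          gcongr with j
          rw [map_add]
          refine (norm_add_le _ _).trans ?_
          gcongr
          exact (M ∘L A ^ j).le_opNorm_of_le (B.le_opNorm _)
      _ ≤ _ := by
          rw [Finset.sum_add_distrib, ← Finset.sum_mul, mul_assoc (‖M‖ / _)]
          gcongr
          exact sum_norm_comp_pow_le A M hA T
  have response := sum_norm_recursion_add_le A M (x := x) (v := fun s => B (u s) + w s)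
    (fun t => by rw [hx, add_assoc]) T 0
  simp only [Finset.range_zero, Finset.sum_empty, add_zero, zero_add] at response
  calc _ ≤ _ := response
    _ ≤ ∑ j ∈ Finset.range T, ‖(M ∘L A ^ j) (x 0)‖ + ∑ s ∈ Finset.range T,
        (‖M‖ / (1 - ‖A‖) * ‖B‖ * ‖u s‖ + ∑ j ∈ Finset.range T, ‖(M ∘L A ^ j) (w s)‖) := by
      gcongr
      exact input_response _
    _ = _ := by
      rw [Finset.sum_add_distrib, Finset.mul_sum]
      ring

end LinearResponse

section LinearSystem

theorem recursion_eq {E : Type*} [NormedAddCommGroup E] [NormedSpace ℝ E] (A : E →L[ℝ] E)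
    {x v : ℕ → E} (hx : ∀ t, x (t + 1) = A (x t) + v t) (s l : ℕ) :
    x (s + l) = (A ^ l) (x s) + ∑ j ∈ Finset.range l, (A ^ j) (v (s + l - 1 - j)) := by
  induction l with
  | zero => simp
  | succ l ih =>
    have shift : ∑ j ∈ Finset.range l, (A ^ (j + 1)) (v (s + l + 1 - 1 - (j + 1)))
        = A (∑ j ∈ Finset.range l, (A ^ j) (v (s + l - 1 - j))) := by
      rw [map_sum]
      exact Finset.sum_congr rfl fun j _ => by
        rw [pow_succ', show s + l + 1 - 1 - (j + 1) = s + l - 1 - j by lia]; rfl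
    rw [← add_assoc, hx, ih, Finset.sum_range_succ', shift, map_add, pow_succ', ← add_assoc]
    rfl

/-- The continuous linear map of a matrix between Euclidean spaces. Its operator norm is the
spectral norm of the matrix by definition. -/
noncomputable def euclideanCLM {a b : ℕ} (M : Matrix (Fin a) (Fin b) ℝ) :
    EuclideanSpace ℝ (Fin b) →L[ℝ] EuclideanSpace ℝ (Fin a) :=
  (Matrix.toEuclideanLin M).toContinuousLinearMap

theorem norm_euclideanCLM {a b : ℕ} (M : Matrix (Fin a) (Fin b) ℝ) :
    ‖euclideanCLM M‖ = specNorm M := rfl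

theorem euclideanCLM_mul {a b c : ℕ} (M : Matrix (Fin a) (Fin b) ℝ)
    (N : Matrix (Fin b) (Fin c) ℝ) :
    euclideanCLM (M * N) = euclideanCLM M ∘L euclideanCLM N :=
  ContinuousLinearMap.ext fun z => LinearMap.congr_fun (Matrix.toLpLin_mul_same 2 M N) z

theorem euclideanCLM_pow {a : ℕ} (M : Matrix (Fin a) (Fin a) ℝ) (j : ℕ) :
    euclideanCLM (M ^ j) = euclideanCLM M ^ j := by
  induction j with
  | zero => ext z; simp [euclideanCLM]
  | succ j ih => rw [pow_succ, euclideanCLM_mul, ih, pow_succ]; rfl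

theorem specNorm_nonneg {a b : ℕ} (M : Matrix (Fin a) (Fin b) ℝ) : 0 ≤ specNorm M :=
  norm_nonneg _

theorem specNorm_mul_le {a b c : ℕ} (M : Matrix (Fin a) (Fin b) ℝ)
    (N : Matrix (Fin b) (Fin c) ℝ) : specNorm (M * N) ≤ specNorm M * specNorm N := by
  simp only [← norm_euclideanCLM, euclideanCLM_mul]
  exact ContinuousLinearMap.opNorm_comp_le _ _

theorem specNorm_pow_le {a : ℕ} (M : Matrix (Fin a) (Fin a) ℝ) {l : ℕ} (hl : 0 < l) :
    specNorm (M ^ l) ≤ specNorm M ^ l := by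
  simp only [← norm_euclideanCLM, euclideanCLM_pow]
  exact norm_pow_le' _ hl

/-- The sequences `x`, `w`, `u`, `y` satisfy the state equation `x_{t+1} = A x_t + B u_t + w_t`
and the output equation `y_t = C x_t + D u_t`. -/
structure IsTrajectory {n m r : ℕ} (A : Matrix (Fin n) (Fin n) ℝ) (B : Matrix (Fin n) (Fin m) ℝ)
    (C : Matrix (Fin r) (Fin n) ℝ) (D : Matrix (Fin r) (Fin m) ℝ)
    (x w : ℕ → EuclideanSpace ℝ (Fin n)) (u : ℕ → EuclideanSpace ℝ (Fin m))
    (y : ℕ → EuclideanSpace ℝ (Fin r)) : Prop where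
  state : ∀ t, x (t + 1) = euclideanCLM A (x t) + euclideanCLM B (u t) + w t
  output : ∀ t, y t = euclideanCLM C (x t) + euclideanCLM D (u t)

variable {n m r : ℕ} {A : Matrix (Fin n) (Fin n) ℝ} {B : Matrix (Fin n) (Fin m) ℝ}
  {C : Matrix (Fin r) (Fin n) ℝ} {D : Matrix (Fin r) (Fin m) ℝ}
  {x w : ℕ → EuclideanSpace ℝ (Fin n)} {u : ℕ → EuclideanSpace ℝ (Fin m)}
  {y : ℕ → EuclideanSpace ℝ (Fin r)}

theorem markovMatrix_mulVec_stackedInput {k : ℕ} (hk : 1 ≤ k) (t : ℕ) :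
    WithLp.toLp 2 ((markovMatrix k A B C D).mulVec (stackedInput k u t)) = euclideanCLM D (u t)
      + ∑ j ∈ Finset.range (2 * k - 1), euclideanCLM (C * A ^ j * B) (u (t - 1 - j)) := by
  let block (j : ℕ) : Matrix (Fin r) (Fin m) ℝ := if j = 0 then D else C * A ^ (j - 1) * B
  have entry (i : Fin r) (c : Fin (2 * k) × Fin m) :
      markovMatrix k A B C D i c = block c.1 i c.2 := by
    simp only [markovMatrix, Matrix.of_apply, block]
    split_ifs <;> rfl
  have blocks : WithLp.toLp 2 ((markovMatrix k A B C D).mulVec (stackedInput k u t))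
      = ∑ j : Fin (2 * k), euclideanCLM (block j) (u (t - j)) := by
    ext i
    simp [Matrix.mulVec, dotProduct, entry, stackedInput, Fintype.sum_prod_type, euclideanCLM,
      Matrix.toLpLin_apply]
  rw [blocks, Fin.sum_univ_eq_sum_range fun j => euclideanCLM (block j) (u (t - j)),
    show 2 * k = 2 * k - 1 + 1 by lia, Finset.sum_range_succ', add_comm]
  simp [block, Nat.sub_sub, add_comm]

theorem output_eq_of_window_eq_zero (h : IsTrajectory A B C D x w u y) {k : ℕ} (hk : 1 ≤ k) {s : ℕ}
    (hw : ∀ t ∈ Finset.Ico s (s + (2 * k - 1)), w t = 0) :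
    y (s + (2 * k - 1))
      = WithLp.toLp 2 ((markovMatrix k A B C D).mulVec (stackedInput k u (s + (2 * k - 1))))
        + euclideanCLM (C * A ^ (2 * k - 1)) (x s) := by
  have state := recursion_eq (euclideanCLM A) (x := x) (v := fun t => euclideanCLM B (u t) + w t)
    (fun t => by rw [h.state, add_assoc]) s (2 * k - 1)
  have inputs : ∑ j ∈ Finset.range (2 * k - 1), (euclideanCLM A ^ j)
        (euclideanCLM B (u (s + (2 * k - 1) - 1 - j)) + w (s + (2 * k - 1) - 1 - j))
      = ∑ j ∈ Finset.range (2 * k - 1),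
        (euclideanCLM A ^ j) (euclideanCLM B (u (s + (2 * k - 1) - 1 - j))) :=
    Finset.sum_congr rfl fun j hj => by
      rw [hw _ (by simp only [Finset.mem_range, Finset.mem_Ico] at hj ⊢; lia), add_zero]
  rw [h.output, state, inputs, markovMatrix_mulVec_stackedInput hk, map_add, map_sum]
  simp only [euclideanCLM_mul, euclideanCLM_pow, ContinuousLinearMap.comp_apply]
  abel

end LinearSystem

section L1Estimator

variable {m r k T : ℕ} {u : ℕ → EuclideanSpace ℝ (Fin m)} {y : ℕ → EuclideanSpace ℝ (Fin r)}

theorem mulVec_stackedInput_apply (hk : 1 ≤ k) (u : ℕ → EuclideanSpace ℝ (Fin m))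
    (G : Matrix (Fin r) (Fin (2 * k) × Fin m) ℝ) (s : ℕ) (i : Fin r) :
    G.mulVec (stackedInput k u (s + (2 * k - 1))) i
      = inner ℝ (WithLp.toLp 2 (G i)) (regressor (2 * k) u s) := by
  have stacked : stackedInput k u (s + (2 * k - 1)) = (regressor (2 * k) u s).ofLp := by
    ext c
    have time_eq : s + (2 * k - 1) - c.1 = s + c.1.rev := by rw [Fin.val_rev]; lia
    simp only [stackedInput, regressor, time_eq]
  rw [stacked, Matrix.mulVec, dotProduct, PiLp.inner_apply]
  simp [mul_comm]

theorem l1Loss_eq_sum (hk : 1 ≤ k) (G : Matrix (Fin r) (Fin (2 * k) × Fin m) ℝ) :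
    l1Loss k T u y G = ∑ i, ∑ s ∈ Finset.range T,
      |y (s + (2 * k - 1)) i - inner ℝ (WithLp.toLp 2 (G i)) (regressor (2 * k) u s)| := by
  have window :
      Finset.Icc (2 * k - 1) (T + 2 * k - 2) = Finset.Ico (2 * k - 1) (2 * k - 1 + T) := by
    ext t
    simp only [Finset.mem_Icc, Finset.mem_Ico]
    lia
  rw [l1Loss, window, Finset.sum_Ico_eq_sum_range, Nat.add_sub_cancel_left, Finset.sum_comm]
  simp only [add_comm (2 * k - 1), mulVec_stackedInput_apply hk]

theorem isL1Estimate_row_le (hk : 1 ≤ k) {G : Matrix (Fin r) (Fin (2 * k) × Fin m) ℝ}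
    (hG : IsL1Estimate k T u y G) (i : Fin r) (g : Fin (2 * k) × Fin m → ℝ) :
    ∑ s ∈ Finset.range T,
        |y (s + (2 * k - 1)) i - inner ℝ (WithLp.toLp 2 (G i)) (regressor (2 * k) u s)|
      ≤ ∑ s ∈ Finset.range T,
        |y (s + (2 * k - 1)) i - inner ℝ (WithLp.toLp 2 g) (regressor (2 * k) u s)| := by
  let rowLoss (i' : Fin r) (g' : Fin (2 * k) × Fin m → ℝ) : ℝ := ∑ s ∈ Finset.range T,
    |y (s + (2 * k - 1)) i' - inner ℝ (WithLp.toLp 2 g') (regressor (2 * k) u s)|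
  have compare : ∑ i', rowLoss i' (G i') ≤ ∑ i', rowLoss i' (G.updateRow i g i') := by
    simpa only [l1Loss_eq_sum hk] using hG (G.updateRow i g)
  have other_rows : ∑ i' ∈ Finset.univ.erase i, rowLoss i' (G.updateRow i g i')
      = ∑ i' ∈ Finset.univ.erase i, rowLoss i' (G i') :=
    Finset.sum_congr rfl fun i' hi' =>
      congrArg (rowLoss i') (Matrix.updateRow_ne (Finset.ne_of_mem_erase hi'))
  rw [← Finset.add_sum_erase _ _ (Finset.mem_univ i),
    ← Finset.add_sum_erase _ _ (Finset.mem_univ i), Matrix.updateRow_self, other_rows] at compare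
  exact le_of_add_le_add_right compare

theorem sign_mul_abs_sub_le {σ a b e h : ℝ} (hσ : σ = 1 ∧ e - a = h ∨ σ = -1) :
    σ * |a - b| ≤ |e - b| - |e - a| + 2 * |h| := by
  rcases hσ with ⟨rfl, rfl⟩ | rfl
  · linarith [abs_sub_le a e b, abs_sub_comm a e]
  · linarith [abs_sub_le e b a, abs_sub_comm a b, abs_nonneg h]

theorem signedSum_row_sub_le {n : ℕ} {A : Matrix (Fin n) (Fin n) ℝ} {B : Matrix (Fin n) (Fin m) ℝ}
    {C : Matrix (Fin r) (Fin n) ℝ} {D : Matrix (Fin r) (Fin m) ℝ}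
    {x w : ℕ → EuclideanSpace ℝ (Fin n)} (h : IsTrajectory A B C D x w u y) (hk : 1 ≤ k)
    {z : ℕ → Bool} (hw : ∀ t, z t = false → w t = 0)
    {G : Matrix (Fin r) (Fin (2 * k) × Fin m) ℝ} (hG : IsL1Estimate k T u y G) (i : Fin r) :
    signedSum (attackSign (2 * k - 1) z) (regressor (2 * k) u) T
        (WithLp.toLp 2 ((markovMatrix k A B C D - G) i))
      ≤ 2 * ∑ s ∈ Finset.range T, |euclideanCLM (C * A ^ (2 * k - 1)) (x s) i| := by
  let a (s : ℕ) : ℝ :=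
    inner ℝ (WithLp.toLp 2 (markovMatrix k A B C D i)) (regressor (2 * k) u s)
  let b (s : ℕ) : ℝ := inner ℝ (WithLp.toLp 2 (G i)) (regressor (2 * k) u s)
  have quiet_or_attacked (s : ℕ) : attackSign (2 * k - 1) z s = 1 ∧
      y (s + (2 * k - 1)) i - a s = euclideanCLM (C * A ^ (2 * k - 1)) (x s) i
        ∨ attackSign (2 * k - 1) z s = -1 := by
    by_cases quiet : ∀ t ∈ Finset.Ico s (s + (2 * k - 1)), z t = false
    · refine .inl ⟨if_pos quiet, ?_⟩
      rw [output_eq_of_window_eq_zero h hk fun t ht => hw t (quiet t ht), PiLp.add_apply]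
      simp only [a, mulVec_stackedInput_apply hk, add_sub_cancel_left]
    · exact .inr (if_neg quiet)
  have row_sub (s : ℕ) : inner ℝ (WithLp.toLp 2 ((markovMatrix k A B C D - G) i))
      (regressor (2 * k) u s) = a s - b s :=
    inner_sub_left (WithLp.toLp 2 (markovMatrix k A B C D i)) (WithLp.toLp 2 (G i)) _
  calc _ = ∑ s ∈ Finset.range T, attackSign (2 * k - 1) z s * |a s - b s| := by
        simp only [signedSum, row_sub]
    _ ≤ ∑ s ∈ Finset.range T, (|y (s + (2 * k - 1)) i - b s| - |y (s + (2 * k - 1)) i - a s|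
          + 2 * |euclideanCLM (C * A ^ (2 * k - 1)) (x s) i|) :=
        Finset.sum_le_sum fun s _ => sign_mul_abs_sub_le (quiet_or_attacked s)
    _ ≤ _ := by
        rw [Finset.sum_add_distrib, Finset.sum_sub_distrib, ← Finset.mul_sum]
        linarith [isL1Estimate_row_le hk hG i (markovMatrix k A B C D i)]

theorem mul_frobNorm_le_of_rows {ι κ : Type*} [Fintype ι] [Fintype κ] {Q : Matrix κ ι ℝ} {b : ℝ}
    (hb : 0 ≤ b) {S : Finset ℕ} {a : ℕ → EuclideanSpace ℝ κ}
    (h : ∀ i, b * ‖(WithLp.toLp 2 (Q i) : EuclideanSpace ℝ ι)‖ ≤ ∑ s ∈ S, |a s i|) :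
    b * frobNorm Q ≤ ∑ s ∈ S, ‖a s‖ := by
  let rows : EuclideanSpace ℝ κ :=
    WithLp.toLp 2 fun i => ‖(WithLp.toLp 2 (Q i) : EuclideanSpace ℝ ι)‖
  let absA (s : ℕ) : EuclideanSpace ℝ κ := WithLp.toLp 2 fun i => |a s i|
  have frob_eq : frobNorm Q = ‖rows‖ := by
    simp [frobNorm, rows, EuclideanSpace.norm_eq, Real.sq_sqrt, Finset.sum_nonneg, sq_nonneg]
  have norm_absA (s : ℕ) : ‖absA s‖ = ‖a s‖ := by
    simp [absA, EuclideanSpace.norm_eq]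
  calc b * frobNorm Q = ‖b • rows‖ := by rw [norm_smul, Real.norm_of_nonneg hb, frob_eq]
    _ ≤ ‖∑ s ∈ S, absA s‖ := by
        rw [EuclideanSpace.norm_eq, EuclideanSpace.norm_eq]
        gcongr with i
        simpa [rows, absA, abs_of_nonneg hb] using (h i).trans (le_abs_self _)
    _ ≤ ∑ s ∈ S, ‖absA s‖ := norm_sum_le _ _
    _ = ∑ s ∈ S, ‖a s‖ := by simp only [norm_absA]

end L1Estimator

section SampleSize

theorem two_mul_one_sub_pow_sub_one_mem_Ioc {p : ℝ} {l : ℕ} (hp0 : 0 ≤ p) (hp1 : p ≤ 1)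
    (hp : 2 * l * p < 1) : 2 * (1 - p) ^ l - 1 ∈ Set.Ioc 0 1 := by
  have bernoulli : 1 + l * -p ≤ (1 + -p) ^ l := one_add_mul_le_pow (by linarith) l
  have pow_le_one : (1 - p) ^ l ≤ 1 := pow_le_one₀ (by linarith) (by linarith)
  rw [← sub_eq_add_neg] at bernoulli
  constructor <;> linarith

theorem exp_neg_le_div_three {δ t : ℝ} (hδ : 0 < δ) (ht : 2 + Real.log (1 / δ) ≤ t) :
    Real.exp (-t) ≤ δ / 3 := by
  have log_three : Real.log 3 ≤ 2 := by linarith [Real.log_le_sub_one_of_pos zero_lt_three]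
  calc Real.exp (-t) ≤ Real.exp (Real.log δ - Real.log 3) := by
        rw [one_div, Real.log_inv] at ht
        gcongr
        linarith
    _ = δ / 3 := by rw [Real.exp_sub, Real.exp_log hδ, Real.exp_log zero_lt_three]

variable {K D θ μ T : ℝ}

theorem log_sample_size_le (hK : 0 ≤ K) (hKD : K ≤ D) (hD : 1 ≤ D) (hθ0 : 0 < θ) (hμ : 0 ≤ μ)
    (hT1 : 40000 ≤ T)
    (hT : 40000 * (K / θ ^ 2 * (D * Real.log (D / θ) + μ)) ≤ T) :
    288 * (K / θ ^ 2 * (D * (16 + 2 * Real.log (D / θ)) + μ)) ≤ T := by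
  have scale_nonneg : 0 ≤ K / θ ^ 2 := by positivity
  rcases le_or_gt 2 (D / θ) with large | small
  · have half_le_log : 1 / 2 ≤ Real.log (D / θ) := by
      linarith [Real.log_two_gt_d9, Real.log_le_log two_pos large]
    have : D * (16 + 2 * Real.log (D / θ)) + μ ≤ 34 * (D * Real.log (D / θ) + μ) := by nlinarith
    nlinarith [mul_le_mul_of_nonneg_left this scale_nonneg]
  · have constant_term : K / θ ^ 2 * D ≤ 4 := by
      calc K / θ ^ 2 * D ≤ D / θ ^ 2 * D := by gcongr
        _ = (D / θ) ^ 2 := by ring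
        _ ≤ 2 ^ 2 := by gcongr
        _ = 4 := by norm_num
    have : 0 ≤ K / θ ^ 2 * μ := by positivity
    linarith

theorem mul_add_le_of_sample_size_le (hK : 0 ≤ K) (hD : 1 ≤ D) (hθ0 : 0 < θ) (hθ1 : θ ≤ 1)
    (hμ : 0 ≤ μ) (hT : 288 * (K / θ ^ 2 * (D * (16 + 2 * Real.log (D / θ)) + μ)) ≤ T) :
    K * (16 + μ) ≤ T := by
  have log_nonneg : 0 ≤ Real.log (D / θ) := Real.log_nonneg ((one_le_div hθ0).2 (hθ1.trans hD))
  have le_scale : K ≤ K / θ ^ 2 := le_div_self hK (by positivity) (pow_le_one₀ hθ0.le hθ1)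
  have le_bracket : 16 + μ ≤ D * (16 + 2 * Real.log (D / θ)) + μ := by nlinarith
  calc K * (16 + μ) ≤ K / θ ^ 2 * (D * (16 + 2 * Real.log (D / θ)) + μ) := by gcongr
    _ ≤ 288 * (K / θ ^ 2 * (D * (16 + 2 * Real.log (D / θ)) + μ)) :=
        le_mul_of_one_le_left (by positivity) (by norm_num)
    _ ≤ T := hT

theorem grid_card_mul_exp_le {δ : ℝ} {d N : ℕ} (hK : 0 < K) (hD : 1 ≤ D) (hθ0 : 0 < θ)
    (hθ1 : θ ≤ 1) (hδ : 0 < δ) (hd : d = 2 * D) (hN : N ≤ 260 * (D / θ) + 1)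
    (hT : 288 * (K / θ ^ 2 * (D * (16 + 2 * Real.log (D / θ)) + Real.log (1 / δ))) ≤ T) :
    (2 * (N : ℝ) + 1) ^ d * Real.exp (-(θ ^ 2 * T / (288 * K))) ≤ δ / 3 := by
  have one_le_ratio : 1 ≤ D / θ := (one_le_div hθ0).2 (hθ1.trans hD)
  have exp_seven : 523 ≤ Real.exp 7 := by
    calc (523 : ℝ) ≤ 2.7 ^ 7 := by norm_num
      _ ≤ Real.exp 1 ^ 7 := by gcongr; linarith [Real.exp_one_gt_d9]
      _ = Real.exp 7 := by rw [← Real.exp_nat_mul]; norm_num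
  have base_le : 2 * (N : ℝ) + 1 ≤ Real.exp (7 + Real.log (D / θ)) := by
    rw [Real.exp_add, Real.exp_log (by positivity)]
    nlinarith
  have exponent_le : D * (16 + 2 * Real.log (D / θ)) + Real.log (1 / δ)
      ≤ θ ^ 2 * T / (288 * K) := by
    rw [le_div_iff₀ (by positivity)]
    calc _ = θ ^ 2 *
          (288 * (K / θ ^ 2 * (D * (16 + 2 * Real.log (D / θ)) + Real.log (1 / δ)))) := by
          field_simp
      _ ≤ θ ^ 2 * T := by gcongr
  calc (2 * (N : ℝ) + 1) ^ d * Real.exp (-(θ ^ 2 * T / (288 * K)))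
      ≤ Real.exp (7 + Real.log (D / θ)) ^ d * Real.exp (-(θ ^ 2 * T / (288 * K))) := by gcongr
    _ = Real.exp (-(θ ^ 2 * T / (288 * K) - 2 * D * (7 + Real.log (D / θ)))) := by
        rw [← Real.exp_nat_mul, hd, ← Real.exp_add]
        ring_nf
    _ ≤ δ / 3 := exp_neg_le_div_three hδ (by linarith)

end SampleSize

section Accuracy

/-- The properties of a realization `(x₀, w, u, z)` of initial state, attacks, inputs and attack
indicators from which the accuracy of every `ℓ₁` estimate is deduced: bounded input energy, bounded
accumulated response to the initial state and the attacks, and positivity of the signed sums on the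
integer grid of size `N`. -/
structure IsTypical {n m r : ℕ} (k T N : ℕ) (A : Matrix (Fin n) (Fin n) ℝ)
    (C : Matrix (Fin r) (Fin n) ℝ) (θ γ η : ℝ) (x₀ : EuclideanSpace ℝ (Fin n))
    (w : ℕ → EuclideanSpace ℝ (Fin n)) (u : ℕ → EuclideanSpace ℝ (Fin m)) (z : ℕ → Bool) :
    Prop where
  energy_le : ∑ t ∈ Finset.range (T + 2 * k - 1), ‖u t‖ ^ 2 ≤ 12 * m * γ ^ 2 * T
  response_le : ∑ j ∈ Finset.range T,
        ‖(euclideanCLM (C * A ^ (2 * k - 1)) ∘L euclideanCLM A ^ j) x₀‖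
      + ∑ s ∈ Finset.range T, ∑ j ∈ Finset.range T,
        ‖(euclideanCLM (C * A ^ (2 * k - 1)) ∘L euclideanCLM A ^ j) (w s)‖
    ≤ 5 * √r * (specNorm (C * A ^ (2 * k - 1)) / (1 - specNorm A)) * η * T
  le_signedSum : ∀ v ∈ gridVectors (Fin (2 * k) × Fin m) N,
    θ * γ * T / 24 * ‖v‖ ≤ signedSum (attackSign (2 * k - 1) z) (regressor (2 * k) u) T v

variable {n m r k T N : ℕ} {A : Matrix (Fin n) (Fin n) ℝ} {B : Matrix (Fin n) (Fin m) ℝ}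
  {C : Matrix (Fin r) (Fin n) ℝ} {D : Matrix (Fin r) (Fin m) ℝ} {θ γ η δ p : ℝ}

section Realization

variable {x w : ℕ → EuclideanSpace ℝ (Fin n)} {u : ℕ → EuclideanSpace ℝ (Fin m)}
  {y : ℕ → EuclideanSpace ℝ (Fin r)} {z : ℕ → Bool}

theorem sum_norm_response_le_of_isTypical [NeZero r] (hk : 1 ≤ k) (hA : specNorm A < 1)
    (hγ : 0 ≤ γ) (hxy : IsTrajectory A B C D x w u y)
    (h : IsTypical k T N A C θ γ η (x 0) w u z) :
    ∑ s ∈ Finset.range T, ‖euclideanCLM (C * A ^ (2 * k - 1)) (x s)‖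
      ≤ 5 * √r * (specNorm (C * A ^ (2 * k - 1)) / (1 - specNorm A)) * T
        * (η + √m * specNorm B * γ) := by
  let K := specNorm (C * A ^ (2 * k - 1)) / (1 - specNorm A)
  have K_nonneg : 0 ≤ K := div_nonneg (specNorm_nonneg _) (by linarith)
  have B_nonneg := specNorm_nonneg B
  have one_le_sqrt : 1 ≤ √(r : ℝ) := Real.one_le_sqrt.2 (mod_cast NeZero.one_le)
  have input_sum_le : ∑ s ∈ Finset.range T, ‖u s‖ ≤ 4 * √m * γ * T := by
    refine sum_norm_le_of_sum_sq_norm_le (by positivity) ?_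
    calc ∑ s ∈ Finset.range T, ‖u s‖ ^ 2
        ≤ ∑ s ∈ Finset.range (T + 2 * k - 1), ‖u s‖ ^ 2 :=
          Finset.sum_le_sum_of_subset_of_nonneg (Finset.range_mono (by lia))
            fun _ _ _ => by positivity
      _ ≤ 12 * m * γ ^ 2 * T := h.energy_le
      _ ≤ 16 * m * γ ^ 2 * T := by gcongr; norm_num
      _ = (4 * √m * γ) ^ 2 * T := by rw [mul_pow, mul_pow, Real.sq_sqrt (by positivity)]; norm_num
  calc ∑ s ∈ Finset.range T, ‖euclideanCLM (C * A ^ (2 * k - 1)) (x s)‖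
      ≤ K * specNorm B * ∑ s ∈ Finset.range T, ‖u s‖ + 5 * √r * K * η * T :=
        (sum_norm_recursion_le _ _ hA _ hxy.state T).trans
          (add_le_add_right h.response_le _)
    _ ≤ K * specNorm B * (5 * √r * √m * γ * T) + 5 * √r * K * η * T := by
        gcongr
        refine input_sum_le.trans ?_
        gcongr
        linarith
    _ = 5 * √r * K * T * (η + √m * specNorm B * γ) := by ring

theorem frobNorm_sub_le_of_isTypical [NeZero m] [NeZero r] (hk : 1 ≤ k) (hA : specNorm A < 1)
    (hT : 0 < T) (hθ0 : 0 < θ) (hθ1 : θ ≤ 1) (hγ : 0 < γ) (hη : 0 ≤ η)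
    (hN : 260 * (k * m / θ) ≤ N) (hxy : IsTrajectory A B C D x w u y)
    (hw : ∀ t, z t = false → w t = 0) (h : IsTypical k T N A C θ γ η (x 0) w u z)
    {G : Matrix (Fin r) (Fin (2 * k) × Fin m) ℝ} (hG : IsL1Estimate k T u y G) :
    frobNorm (markovMatrix k A B C D - G) ≤
      960 * (specNorm (A ^ (2 * k - 1)) * specNorm C * √r / ((1 - specNorm A) * θ)
        * (η / γ + √m * specNorm B)) := by
  have gap_pos : 0 < 1 - specNorm A := by linarith
  have B_nonneg := specNorm_nonneg B
  have sign_le (s : ℕ) : |attackSign (2 * k - 1) z s| ≤ 1 := by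
    rcases attackSign_eq_one_or (2 * k - 1) z s with h | h <;> simp [h]
  have resolution : 130 * ((2 * k : ℕ) * Fintype.card (Fin m)) ≤ N * θ := by
    rw [mul_div_assoc', div_le_iff₀ hθ0] at hN
    rw [Fintype.card_fin]
    push_cast
    linarith
  have row_le (i : Fin r) := (mul_norm_le_signedSum_of_energy_le (by lia) hθ0 hθ1 hγ.le sign_le
    (by simpa using h.energy_le) resolution h.le_signedSum _).trans
      (signedSum_row_sub_le hxy hk hw hG i)
  have frob_le : θ * γ * T / 192 * frobNorm (markovMatrix k A B C D - G)
      ≤ ∑ s ∈ Finset.range T, ‖euclideanCLM (C * A ^ (2 * k - 1)) (x s)‖ :=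
    mul_frobNorm_le_of_rows (by positivity) fun i => by linarith [row_le i]
  refine le_of_mul_le_mul_left (frob_le.trans
    ((sum_norm_response_le_of_isTypical hk hA hγ.le hxy h).trans ?_))
    (show 0 < θ * γ * T / 192 by positivity)
  calc 5 * √r * (specNorm (C * A ^ (2 * k - 1)) / (1 - specNorm A)) * T
        * (η + √m * specNorm B * γ)
      ≤ 5 * √r * (specNorm C * specNorm (A ^ (2 * k - 1)) / (1 - specNorm A)) * T
        * (η + √m * specNorm B * γ) := by gcongr; exact specNorm_mul_le _ _
    _ = _ := by field_simp; ring

end Realization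

section Probability

variable {Ω : Type*} [MeasurableSpace Ω] {P : Measure Ω}

theorem exists_measurableSet_of_measure_not_le [IsProbabilityMeasure P] (hδ : 0 ≤ δ)
    {Q : Ω → Prop} (h : P {ω | ¬ Q ω} ≤ ENNReal.ofReal δ) :
    ∃ E, MeasurableSet E ∧ ENNReal.ofReal (1 - δ) ≤ P E ∧ ∀ ω ∈ E, Q ω := by
  have meas := measurableSet_toMeasurable P {ω | ¬ Q ω}
  refine ⟨(toMeasurable P {ω | ¬ Q ω})ᶜ, meas.compl, ?_,
    fun ω hω => not_not.1 fun hQ => hω (subset_toMeasurable _ _ hQ)⟩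
  rw [prob_compl_eq_one_sub meas, measure_toMeasurable, ENNReal.ofReal_sub _ hδ,
    ENNReal.ofReal_one]
  exact tsub_le_tsub_left h 1

variable {x₀ : Ω → EuclideanSpace ℝ (Fin n)} {w : ℕ → Ω → EuclideanSpace ℝ (Fin n)}
  {u : ℕ → Ω → EuclideanSpace ℝ (Fin m)} {ξ : ℕ → Ω → Bool}

theorem measure_lt_sum_norm_response_le [IsProbabilityMeasure P] {ι : Type*} [Fintype ι]
    (hw : IsSubGaussianAttack x₀ w η P) (hη : 0 < η)
    {F : EuclideanSpace ℝ (Fin n) →L[ℝ] EuclideanSpace ℝ (Fin n)} (hF : ‖F‖ < 1)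
    (M : EuclideanSpace ℝ (Fin n) →L[ℝ] EuclideanSpace ℝ ι) (hT : 1 ≤ T) :
    P {ω | 5 * √(Fintype.card ι) * (‖M‖ / (1 - ‖F‖)) * η * T
        < ∑ j ∈ Finset.range T, ‖(M ∘L F ^ j) (x₀ ω)‖
          + ∑ s ∈ Finset.range T, ∑ j ∈ Finset.range T, ‖(M ∘L F ^ j) (w s ω)‖}
      ≤ ENNReal.ofReal (Real.exp (-T)) := by
  have threshold_le : 5 * √(Fintype.card ι) * (∑ j ∈ Finset.range T, ‖M ∘L F ^ j‖) * η * T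
      ≤ 5 * √(Fintype.card ι) * (‖M‖ / (1 - ‖F‖)) * η * T := by
    gcongr
    exact sum_norm_comp_pow_le F M hF T
  exact (measure_mono fun ω hω => threshold_le.trans_lt hω).trans
    (measure_lt_sum_norm_history_le hw hη (Finset.range T) (fun j => M ∘L F ^ j) hT)

theorem measure_not_isTypical_le [IsProbabilityMeasure P] [NeZero m] (hk : 1 ≤ k)
    (hA : specNorm A < 1) (hθ : 2 * (1 - p) ^ (2 * k - 1) - 1 = θ) (hθ0 : 0 < θ) (hγ : 0 < γ)
    (hη : 0 < η) (hw : IsSubGaussianAttack x₀ w η P)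
    (hξ : IsBernoulliSeq ξ p P) (hu : IsGaussianNoise u γ P)
    (huξ : IndepFun (fun ω t => u t ω) (fun ω t => ξ t ω) P) (hkT : 2 * k ≤ T) (hδ : 0 ≤ δ)
    (hexp : Real.exp (-T) ≤ δ / 3)
    (hgrid : (2 * (N : ℝ) + 1) ^ (2 * k * m) * Real.exp (-(θ ^ 2 * T / (288 * k))) ≤ δ / 3) :
    P {ω | ¬ IsTypical k T N A C θ γ η (x₀ ω) (fun t => w t ω) (fun t => u t ω) fun t => ξ t ω}
      ≤ ENNReal.ofReal δ := by
  let M := euclideanCLM (C * A ^ (2 * k - 1))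
  let excessEnergy :=
    {ω | 12 * m * γ ^ 2 * T < ∑ t ∈ Finset.range (T + 2 * k - 1), ‖u t ω‖ ^ 2}
  let excessResponse := {ω | 5 * √r * (specNorm (C * A ^ (2 * k - 1)) / (1 - specNorm A)) * η * T
    < ∑ j ∈ Finset.range T, ‖(M ∘L euclideanCLM A ^ j) (x₀ ω)‖
      + ∑ s ∈ Finset.range T, ∑ j ∈ Finset.range T, ‖(M ∘L euclideanCLM A ^ j) (w s ω)‖}
  let smallSignedSum := {ω | ∃ v ∈ gridVectors (Fin (2 * k) × Fin m) N,
    signedSum (attackSign (2 * k - 1) fun t => ξ t ω) (regressor (2 * k) fun t => u t ω) T v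
      < θ * γ * T / 24 * ‖v‖}
  have energy : P excessEnergy ≤ ENNReal.ofReal (δ / 3) := by
    refine le_trans ?_ (ENNReal.ofReal_le_ofReal hexp)
    simpa [excessEnergy] using measure_energy_gt_le hu hγ.ne' (n := T + 2 * k - 1) (T := T) (by lia)
  have response : P excessResponse ≤ ENNReal.ofReal (δ / 3) := by
    refine le_trans ?_ (ENNReal.ofReal_le_ofReal hexp)
    simpa only [Fintype.card_fin] using! measure_lt_sum_norm_response_le hw hη
      (F := euclideanCLM A) hA M (T := T) (by lia)
  have signed_sum : P smallSignedSum ≤ ENNReal.ofReal (δ / 3) := by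
    refine (measure_exists_gridVectors_signedSum_lt_le hu hξ huξ (by lia) (by lia) hkT hθ hθ0 hγ
      N).trans (ENNReal.ofReal_le_ofReal ?_)
    convert hgrid using 5
    · simp
    · push_cast; ring
  calc _ ≤ P (excessEnergy ∪ excessResponse ∪ smallSignedSum) := measure_mono fun ω hω => by
        by_contra good
        simp only [excessEnergy, excessResponse, smallSignedSum, Set.mem_union, Set.mem_ofPred_eq,
          not_or, not_lt, not_exists, not_and] at good
        exact hω ⟨good.1.1, good.1.2, good.2⟩
    _ ≤ ENNReal.ofReal (δ / 3) + ENNReal.ofReal (δ / 3) + ENNReal.ofReal (δ / 3) :=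
        (measure_union_le _ _).trans
          (add_le_add ((measure_union_le _ _).trans (add_le_add energy response)) signed_sum)
    _ = ENNReal.ofReal δ := by
        rw [← ENNReal.ofReal_add (by positivity) (by positivity),
          ← ENNReal.ofReal_add (by positivity) (by positivity)]
        ring_nf

end Probability

end Accuracy

theorem measure_not_isTypical_le_of_sample_size {Ω : Type*} [MeasurableSpace Ω] {P : Measure Ω}
    [IsProbabilityMeasure P] {n m r k T : ℕ} [NeZero m] [NeZero r] (hk : 1 ≤ k)
    {A : Matrix (Fin n) (Fin n) ℝ} (hA : specNorm A < 1) {C : Matrix (Fin r) (Fin n) ℝ}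
    {θ γ η δ p : ℝ} (hθ : 2 * (1 - p) ^ (2 * k - 1) - 1 = θ) (hθ0 : 0 < θ) (hθ1 : θ ≤ 1)
    (hγ : 0 < γ) (hη : 0 < η) {x₀ : Ω → EuclideanSpace ℝ (Fin n)}
    {w : ℕ → Ω → EuclideanSpace ℝ (Fin n)} {u : ℕ → Ω → EuclideanSpace ℝ (Fin m)}
    {ξ : ℕ → Ω → Bool} (hw : IsSubGaussianAttack x₀ w η P) (hξ : IsBernoulliSeq ξ p P)
    (hu : IsGaussianNoise u γ P)
    (huξ : IndepFun (fun ω t => u t ω) (fun ω t => ξ t ω) P) (hδ0 : 0 < δ) (hδ1 : δ ≤ 1)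
    (hT1 : 40000 ≤ (T : ℝ))
    (hT : 40000 * (k / θ ^ 2 * (k * m * Real.log (k * m / θ) + Real.log (r / δ))) ≤ T) :
    P {ω | ¬ IsTypical k T ⌈260 * (k * m / θ)⌉₊ A C θ γ η (x₀ ω) (fun t => w t ω)
        (fun t => u t ω) fun t => ξ t ω} ≤ ENNReal.ofReal δ := by
  have one_le_k : 1 ≤ (k : ℝ) := mod_cast hk
  have one_le_m : 1 ≤ (m : ℝ) := mod_cast NeZero.one_le
  have one_le_r : 1 ≤ (r : ℝ) := mod_cast NeZero.one_le
  have k_le_dim : (k : ℝ) ≤ k * m := le_mul_of_one_le_right (by positivity) one_le_m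
  have one_le_dim : 1 ≤ (k : ℝ) * m := one_le_k.trans k_le_dim
  have log_nonneg : 0 ≤ Real.log (1 / δ) := Real.log_nonneg ((one_le_div hδ0).2 hδ1)
  have size := log_sample_size_le (μ := Real.log (1 / δ)) (by positivity) k_le_dim one_le_dim hθ0
    log_nonneg hT1 (hT.trans' (by gcongr))
  have size_ge : k * (16 + Real.log (1 / δ)) ≤ T :=
    mul_add_le_of_sample_size_le (by positivity) one_le_dim hθ0 hθ1 log_nonneg size
  have window_le : 2 * k ≤ T := by
    have : 2 * (k : ℝ) ≤ T := by nlinarith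
    exact_mod_cast this
  exact measure_not_isTypical_le hk hA hθ hθ0 hγ hη hw hξ hu huξ window_le hδ0.le
    (exp_neg_le_div_three hδ0 (by nlinarith))
    (grid_card_mul_exp_le (by positivity) one_le_dim hθ0 hθ1 hδ0 (by push_cast; ring)
      (Nat.ceil_lt_add_one (by positivity)).le size)

theorem exists_measurableSet_frobNorm_sub_le {Ω : Type*} [MeasurableSpace Ω] {P : Measure Ω}
    [IsProbabilityMeasure P] {n m r k T : ℕ} (hk : 1 ≤ k) {A : Matrix (Fin n) (Fin n) ℝ}
    {B : Matrix (Fin n) (Fin m) ℝ} {C : Matrix (Fin r) (Fin n) ℝ} {D : Matrix (Fin r) (Fin m) ℝ}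
    (hA : specNorm A < 1) {θ γ η δ p : ℝ} (hθ : 2 * (1 - p) ^ (2 * k - 1) - 1 = θ) (hθ0 : 0 < θ)
    (hθ1 : θ ≤ 1) (hγ : 0 < γ) (hη : 0 < η) (hδ0 : 0 < δ) (hδ1 : δ ≤ 1)
    {x w : ℕ → Ω → EuclideanSpace ℝ (Fin n)} {u : ℕ → Ω → EuclideanSpace ℝ (Fin m)}
    {y : ℕ → Ω → EuclideanSpace ℝ (Fin r)} {ξ : ℕ → Ω → Bool}
    (hw : IsSubGaussianAttack (x 0) w η P)
    (hxy : ∀ ω, IsTrajectory A B C D (fun t => x t ω) (fun t => w t ω) (fun t => u t ω)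
      fun t => y t ω)
    (hξ : IsBernoulliSeq ξ p P) (hξw : ∀ t ω, ξ t ω = false → w t ω = 0)
    (hu : IsGaussianNoise u γ P)
    (huξ : IndepFun (fun ω t => u t ω) (fun ω t => ξ t ω) P) (hT1 : 40000 ≤ (T : ℝ))
    (hT : 40000 * (k / θ ^ 2 * (k * m * Real.log (k * m / θ) + Real.log (r / δ))) ≤ T) :
    ∃ E, MeasurableSet E ∧ ENNReal.ofReal (1 - δ) ≤ P E ∧
      ∀ ω ∈ E, ∀ G, IsL1Estimate k T (fun t => u t ω) (fun t => y t ω) G →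
        frobNorm (markovMatrix k A B C D - G) ≤
          960 * (specNorm (A ^ (2 * k - 1)) * specNorm C * √r / ((1 - specNorm A) * θ)
            * (η / γ + √m * specNorm B)) := by
  rcases Nat.eq_zero_or_pos (r * m) with empty | nonempty
  · have bound_nonneg : 0 ≤ 960 * (specNorm (A ^ (2 * k - 1)) * specNorm C * √r
        / ((1 - specNorm A) * θ) * (η / γ + √m * specNorm B)) := by
      have := specNorm_nonneg (A ^ (2 * k - 1))
      have := specNorm_nonneg B
      have := specNorm_nonneg C
      have : 0 < 1 - specNorm A := by linarith
      positivity
    refine ⟨.univ, .univ, by simp [hδ0.le], fun ω _ G _ => bound_nonneg.trans_eq' ?_⟩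
    rcases Nat.mul_eq_zero.1 empty with rfl | rfl <;> simp [frobNorm]
  · have : NeZero r := ⟨(Nat.pos_of_mul_pos_right nonempty).ne'⟩
    have : NeZero m := ⟨(Nat.pos_of_mul_pos_left nonempty).ne'⟩
    have T_pos : 0 < T := by
      have : 0 < (T : ℝ) := by linarith
      exact_mod_cast this
    obtain ⟨E, hE, hPE, typical⟩ := exists_measurableSet_of_measure_not_le hδ0.le
      (measure_not_isTypical_le_of_sample_size (C := C) hk hA hθ hθ0 hθ1 hγ hη hw hξ
        hu huξ hδ0 hδ1 hT1 hT)
    exact ⟨E, hE, hPE, fun ω hω _ hG => frobNorm_sub_le_of_isTypical hk hA T_pos hθ0 hθ1 hγ hη.le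
      (Nat.le_ceil _) (hxy ω) (fun t => hξw t ω) (typical ω hω) hG⟩

theorem theorem3_general {Ω : Type*} [MeasurableSpace Ω] {P : Measure Ω} [IsProbabilityMeasure P]
    {n m r k T : ℕ} (hk : 1 ≤ k) {A : Matrix (Fin n) (Fin n) ℝ} {B : Matrix (Fin n) (Fin m) ℝ}
    {C : Matrix (Fin r) (Fin n) ℝ} {D : Matrix (Fin r) (Fin m) ℝ} (hA : specNorm A < 1)
    {η γ p q δ : ℝ} (hη : 0 < η) (hγ : 0 < γ) (hp0 : 0 ≤ p) (hp : p < 1 / (4 * (k : ℝ) - 2))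
    (hq : q = 1 - (1 - p) ^ (2 * k - 1)) (hδ0 : 0 < δ) (hδ1 : δ ≤ 1)
    {x w : ℕ → Ω → EuclideanSpace ℝ (Fin n)} {u : ℕ → Ω → EuclideanSpace ℝ (Fin m)}
    {y : ℕ → Ω → EuclideanSpace ℝ (Fin r)} {ξ : ℕ → Ω → Bool}
    (hw : IsSubGaussianAttack (x 0) w η P)
    (hxy : ∀ ω, IsTrajectory A B C D (fun t => x t ω) (fun t => w t ω) (fun t => u t ω)
      fun t => y t ω)
    (hξ : IsBernoulliSeq ξ p P) (hξw : ∀ t ω, ξ t ω = false → w t ω = 0)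
    (hu : IsGaussianNoise u γ P)
    (huξ : IndepFun (fun ω t => u t ω) (fun ω t => ξ t ω) P) (hT1 : 40000 ≤ (T : ℝ))
    (hT : 40000 * (k / (1 - 2 * q) ^ 2 *
      (k * m * Real.log (k * m / (1 - 2 * q)) + Real.log (r / δ))) ≤ T) :
    q < 1 / 2 ∧
    ∃ E, MeasurableSet E ∧ ENNReal.ofReal (1 - δ) ≤ P E ∧
      ∀ ω ∈ E, ∀ G, IsL1Estimate k T (fun t => u t ω) (fun t => y t ω) G →
        frobNorm (markovMatrix k A B C D - G) ≤
          960 * (specNorm (A ^ (2 * k - 1)) * specNorm C * √r / ((1 - specNorm A) * (1 - 2 * q))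
            * (η / γ + √m * specNorm B)) ∧
        frobNorm (markovMatrix k A B C D - G) ≤
          960 * (specNorm A ^ (2 * k - 1) * specNorm C * √r / ((1 - specNorm A) * (1 - 2 * q))
            * (η / γ + √m * specNorm B)) := by
  have hθ : 2 * (1 - p) ^ (2 * k - 1) - 1 = 1 - 2 * q := by rw [hq]; ring
  have attack_rate : p ≤ 1 ∧ 2 * (2 * k - 1 : ℕ) * p < 1 := by
    have one_le_k : 1 ≤ (k : ℝ) := mod_cast hk
    rw [lt_div_iff₀ (by linarith)] at hp
    push_cast [show 1 ≤ 2 * k by lia]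
    constructor <;> nlinarith
  obtain ⟨θ_pos, θ_le_one⟩ :=
    hθ ▸ two_mul_one_sub_pow_sub_one_mem_Ioc hp0 attack_rate.1 attack_rate.2
  refine ⟨by linarith, ?_⟩
  obtain ⟨E, hE, hPE, accurate⟩ := exists_measurableSet_frobNorm_sub_le hk hA hθ θ_pos θ_le_one
    hγ hη hδ0 hδ1 hw hxy hξ hξw hu huξ hT1 hT
  refine ⟨E, hE, hPE, fun ω hω G hG => ⟨accurate ω hω G hG, (accurate ω hω G hG).trans ?_⟩⟩
  have := specNorm_nonneg B
  have := specNorm_nonneg C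
  have : 0 < 1 - specNorm A := by linarith
  gcongr
  exact specNorm_pow_le A (by lia)

theorem theorem3 :
    ∃ c₁ c₂ : ℝ, 0 < c₁ ∧ 0 < c₂ ∧
      ∀ (n m r k : ℕ) (_ : 1 ≤ k)
        (A : Matrix (Fin n) (Fin n) ℝ) (B : Matrix (Fin n) (Fin m) ℝ)
        (C : Matrix (Fin r) (Fin n) ℝ) (D : Matrix (Fin r) (Fin m) ℝ)
        (_ : specNorm A < 1)
        (η γ p q δ : ℝ) (_ : 0 < η) (_ : 0 < γ)
        (_ : 0 ≤ p) (_ : p < 1 / (4 * (k : ℝ) - 2)) (_ : q = 1 - (1 - p) ^ (2 * k - 1))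
        (_ : 0 < δ) (_ : δ ≤ 1)
        (Ω : Type*) [MeasurableSpace Ω] (P : Measure Ω) [IsProbabilityMeasure P]
        (x w : ℕ → Ω → EuclideanSpace ℝ (Fin n)) (u : ℕ → Ω → EuclideanSpace ℝ (Fin m))
        (y : ℕ → Ω → EuclideanSpace ℝ (Fin r)) (ξ : ℕ → Ω → Bool)
        -- measurability of the initial state, attacks, inputs and attack indicators
        (_ : Measurable (x 0)) (_ : ∀ t, Measurable (w t)) (_ : ∀ t, Measurable (u t))
        (_ : ∀ t, Measurable (ξ t))
        -- the system
        (_ : ∀ t ω, x (t + 1) ω =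
          Matrix.toEuclideanLin A (x t ω) + Matrix.toEuclideanLin B (u t ω) + w t ω)
        (_ : ∀ t ω, y t ω = Matrix.toEuclideanLin C (x t ω) + Matrix.toEuclideanLin D (u t ω))
        -- sub-Gaussian initial state and conditionally sub-Gaussian attacks
        (_ : vecPsi2Norm (x 0) P ≤ ENNReal.ofReal η)
        (_ : ∀ t, CondPsi2Le P (w t) (history (x 0) w t) η)
        -- attack times
        (_ : iIndepFun ξ P)
        (_ : ∀ t, P {ω | ξ t ω = true} = ENNReal.ofReal p)
        (_ : ∀ t, IndepFun (ξ t) (history (x 0) w t) P)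
        (_ : ∀ t ω, ξ t ω = false → w t ω = 0)
        -- independent Gaussian inputs, independent of the attack times
        (_ : iIndepFun u P)
        (_ : ∀ t, HasLaw (u t) (multivariateGaussian 0 (γ ^ 2 • (1 : Matrix (Fin m) (Fin m) ℝ))) P)
        (_ : IndepFun (fun ω t => u t ω) (fun ω t => ξ t ω) P)
        -- the sample size
        (T : ℕ) (_ : c₁ ≤ (T : ℝ))
        (_ : c₁ * ((k : ℝ) / (1 - 2 * q) ^ 2 *
          ((k : ℝ) * m * Real.log ((k : ℝ) * m / (1 - 2 * q)) + Real.log ((r : ℝ) / δ))) ≤ (T : ℝ)),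
        q < 1 / 2 ∧
        ∃ E : Set Ω, MeasurableSet E ∧ ENNReal.ofReal (1 - δ) ≤ P E ∧
          ∀ ω ∈ E, ∀ G : Matrix (Fin r) (Fin (2 * k) × Fin m) ℝ,
            IsL1Estimate k T (fun t => u t ω) (fun t => y t ω) G →
            frobNorm (markovMatrix k A B C D - G) ≤
              c₂ * (specNorm (A ^ (2 * k - 1)) * specNorm C * √(r : ℝ) /
                ((1 - specNorm A) * (1 - 2 * q)) * (η / γ + √(m : ℝ) * specNorm B)) ∧
            frobNorm (markovMatrix k A B C D - G) ≤
              c₂ * (specNorm A ^ (2 * k - 1) * specNorm C * √(r : ℝ) /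
                ((1 - specNorm A) * (1 - 2 * q)) * (η / γ + √(m : ℝ) * specNorm B)) := by
  refine ⟨40000, 960, by norm_num, by norm_num, ?_⟩
  intro n m r k hk A B C D hA η γ p q δ hη hγ hp0 hp hq hδ0 hδ1 Ω _ P _ x w u y ξ hx₀ hw hu hξ
    hx hy hx₀η hwη hξ_indep hξ_law _ hξw hu_indep hu_law huξ T hT1 hT
  exact theorem3_general hk hA hη hγ hp0 hp hq hδ0 hδ1 ⟨hx₀, hw, hx₀η, hwη⟩
    (fun ω => ⟨fun t => hx t ω, fun t => hy t ω⟩)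
    ⟨hξ, hξ_indep, fun t => by rw [measureReal_def, hξ_law, ENNReal.toReal_ofReal hp0]⟩ hξw
    ⟨hu, hu_indep, hu_law⟩ huξ hT1 hT
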